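/- **Setting.** Let $N\ge 0$, let $\ell_1,\dots,\ell_N$ be spins with $2\ell_i\in\mathbb Z_{\ge 0}$, and let $z_1,\dots,z_N\in\mathbb C\setminus\{0\}$. For $\gamma\in\mathbb C$ put $q=e^{i\gamma}$, $q^x=e^{i\gamma x}$ and $[x]=(q^x-q^{-x})/(q-q^{-1})$. On $V_\ell=\bigoplus_{r=0}^{2\ell}\mathbb C v_r$ let $$E v_r=[r]\,v_{r-1},\qquad F v_r=[2\ell-r]\,v_{r+1},\qquad H v_r=(\ell-r)\,v_r,$$ $$L(u)=\begin{pmatrix}u q^{H}-q^{-H}& u(q-q^{-1})F\\ (q-q^{-1})E& u q^{-H}-q^{H}\end{pmatrix},$$ and let the operators $A(u),B(u),C(u),D(u)$ on $V_{\ell_1}\otimes\cdots\otimes V_{\ell_N}$ be the entries of the monodromy matrix $$z_1\cdots z_N\,L_N(u/z_N)\cdots L_1(u/z_1)=\begin{pmatrix}A(u)&B(u)\\ C(u)&D(u)\end{pmatrix},$$ where $L_i$ acts in the $i$-th factor. We write $B(u;q)$ to show the dependence on $q$. The transfer matrix is $T(u)=A(u)+\kappa D(u)$. Put $$\mathcal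 A(u)=\prod_{i=1}^N(uq^{\ell_i}-z_iq^{-\ell_i}),\qquad \mathcal D(u)=\prod_{i=1}^N(uq^{-\ell_i}-z_iq^{\ell_i}),\qquad |t\rangle=B(t_1)\cdots B(t_k)\,v_0\otimes\cdots\otimes v_0 .$$ The Bethe equations for $t_1,\dots,t_k\in\mathbb C$ are $$\mathcal A(t_a)\prod_{b\ne a}(t_a-t_bq^2)=\kappa\,\mathcal D(t_a)\prod_{b\ne a}(t_aq^2-t_b),\qquad a=1,\dots,k,$$ and a solution is called offdiagonal if $t_a\ne t_b$ for all $a\ne b$. Fix integers $M>1$ and $K$ coprime with $M$. Let $\gamma_0=\pi K/M$, $q_0=e^{i\gamma_0}$, $\eta=q/q_0$ and $\eta^x=e^{i(\gamma-\gamma_0)x}$. From now on $q=q_0$ (that is, $\gamma=\gamma_0$) unless the dependence on $q$ is displayed. For $u\in\mathbb C$ and $X=(x_1,\dots,x_M)\in\mathbb C^M$ put $$\mathbb B(u;X)=\lim_{q\to q_0}(q-q_0)^{-1}B(u\eta^{x_1};q)\,B(uq^2\eta^{x_2};q)\cdots B(uq^{2M-2}\eta^{x_M};q),$$ where $q=e^{i\gamma}$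 and $\gamma\to\gamma_0$. For $n\in\mathbb Z$ let $$P(u)=\prod_{i=1}^N\prod_{r=0}^{2\ell_i-1}\bigl(u-z_iq_0^{2(\ell_i-r)}\bigr),\qquad Q_n(u;t)=\frac{u^{k-n}P(u)}{\prod_{a=1}^k(u-t_a)(u-t_aq_0^2)},$$ $$F_n(u;t)=\frac1M\sum_{r=0}^{M-1}Q_n(uq_0^{2r};t),\qquad G_n(u;t)=\frac1M\sum_{r=1}^{M-1}r\,Q_n(uq_0^{2r};t),$$ $$x_r^{(n)}(u;t)=2\Bigl(1-r-\frac{G_n(uq_0^{2r};t)}{F_n(u;t)}\Bigr)\quad(r=1,\dots,M),\qquad X^{(n)}(u;t)=\bigl(x_1^{(n)}(u;t),\dots,x_M^{(n)}(u;t)\bigr),$$ and, with $X_i^{(n)}=X^{(n)}(u_i;t)$, $$|||t;u\rangle\!\rangle_n=\mathbb B(u_1;X_1^{(n)})\cdots\mathbb B(u_m;X_m^{(n)})\,|t\rangle .$$ **Proposition 3.1.** The limit defining $\mathbb B(u;X)$ exists for all $u\in\mathbb C$ and $X\in\mathbb C^M$. Let $\kappa=q_0^{2(p-\ell_1-\cdots-\ell_N)}$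 for an integer $p$, let $t_1,\dots,t_k$ be an offdiagonal solution of the Bethe equations at $q=q_0$, and let $u_1,\dots,u_m\in\mathbb C$ satisfy $F_p(u_i;t)\ne0$ and $u_i^M\ne t_a^M$ for all $i=1,\dots,m$ and $a=1,\dots,k$. Then for every $u\in\mathbb C\setminus\{t_1,\dots,t_k\}$ $$T(u)\,|||t;u_1,\dots,u_m\rangle\!\rangle_p=q_0^{mM}\Bigl(\mathcal A(u)\prod_{a=1}^k\frac{uq_0^{-1}-t_aq_0}{u-t_a}+\kappa\,\mathcal D(u)\prod_{a=1}^k\frac{uq_0-t_aq_0^{-1}}{u-t_a}\Bigr)|||t;u_1,\dots,u_m\rangle\!\rangle_p .$$ In particular, if this vector is nonzero, it is an eigenvector of $T(u)$, and its eigenvalue is $q_0^{mM}$ times the usual Bethe eigenvalue for $t_1,\dots,t_k$ and does not depend on $u_1,\dots,u_m$. -/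

import Mathlib

noncomputable section

namespace XXZ

open Complex Filter Topology

/-! ### Powers of `q` and `q`-numbers

The anisotropy `γ` is the basic parameter, `q = e^{iγ}`, and `q ^ x` means `e^{iγx}` for every
complex `x`; this fixes the branch of `q ^ (1/2)`. Spins are encoded by the natural numbers
`s = 2ℓ`. -/

/-- `q ^ x = e^{iγx}`. -/
def qpow (γ x : ℂ) : ℂ := exp (I * γ * x)

/-- The parameter `q = e^{iγ}` itself. -/
def qval (γ : ℂ) : ℂ := qpow γ 1

/-- The `q`-number `[x] = (q ^ x - q ^ (-x)) / (q - q⁻¹)`. -/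
def qnum (γ x : ℂ) : ℂ := (qpow γ x - qpow γ (-x)) / (qval γ - (qval γ)⁻¹)

/-! ### The spin `ℓ = s / 2` representation and the `L`-operator

Operators on `V_ℓ = ⨁_{r = 0}^{2ℓ} ℂ v_r` are matrices in the basis `v_0, …, v_{2ℓ}`. -/

/-- `E v_r = [r] v_{r-1}`. -/
def opE (γ : ℂ) (s : ℕ) : Matrix (Fin (s + 1)) (Fin (s + 1)) ℂ :=
  Matrix.of fun a b => if (a : ℕ) + 1 = (b : ℕ) then qnum γ ((b : ℕ) : ℂ) else 0

/-- `F v_r = [2ℓ - r] v_{r+1}`. -/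
def opF (γ : ℂ) (s : ℕ) : Matrix (Fin (s + 1)) (Fin (s + 1)) ℂ :=
  Matrix.of fun a b =>
    if (a : ℕ) = (b : ℕ) + 1 then qnum γ ((s : ℂ) - ((b : ℕ) : ℂ)) else 0

/-- `q ^ (σ H)`, where `H v_r = (ℓ - r) v_r`. -/
def opQH (γ : ℂ) (s : ℕ) (σ : ℂ) : Matrix (Fin (s + 1)) (Fin (s + 1)) ℂ :=
  Matrix.diagonal fun r => qpow γ (σ * ((s : ℂ) / 2 - ((r : ℕ) : ℂ)))

/-- The `L`-operator, a `2 × 2` matrix with entries in `End V_ℓ`. -/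
def Lop (γ : ℂ) (s : ℕ) (u : ℂ) :
    Matrix (Fin 2) (Fin 2) (Matrix (Fin (s + 1)) (Fin (s + 1)) ℂ) :=
  !![u • opQH γ s 1 - opQH γ s (-1), (u * (qval γ - (qval γ)⁻¹)) • opF γ s;
     (qval γ - (qval γ)⁻¹) • opE γ s, u • opQH γ s (-1) - opQH γ s 1]

/-! ### The chain

`V_{ℓ_1} ⊗ ⋯ ⊗ V_{ℓ_N}` has the basis `v_{r_1} ⊗ ⋯ ⊗ v_{r_N}`, indexed by `Conf s`. Vectors are
functions `Conf s → ℂ` and operators are matrices over `Conf s`. -/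

/-- Indices `(r_1, …, r_N)`, `0 ≤ r_i ≤ 2ℓ_i`, of the basis vectors of the tensor product. -/
abbrev Conf {N : ℕ} (s : Fin N → ℕ) : Type := (i : Fin N) → Fin (s i + 1)

/-- Operators on the tensor product. -/
abbrev Op {N : ℕ} (s : Fin N → ℕ) : Type := Matrix (Conf s) (Conf s) ℂ

/-- The operator `1 ⊗ ⋯ ⊗ X ⊗ ⋯ ⊗ 1` with `X` in the `i`-th factor. -/
def localOp {N : ℕ} (s : Fin N → ℕ) (i : Fin N)
    (X : Matrix (Fin (s i + 1)) (Fin (s i + 1)) ℂ) : Op s :=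
  Matrix.of fun a b => if ∀ j, j ≠ i → a j = b j then X (a i) (b i) else 0

/-- The monodromy matrix `z_1 ⋯ z_N L_N(u / z_N) ⋯ L_1(u / z_1)`, where `L_i` acts in the
`i`-th factor. -/
def monodromy {N : ℕ} (s : Fin N → ℕ) (z : Fin N → ℂ) (γ u : ℂ) :
    Matrix (Fin 2) (Fin 2) (Op s) :=
  (∏ i, z i) •
    ((List.ofFn fun i : Fin N => (Lop γ (s i) (u / z i)).map (localOp s i)).reverse).prod

/-- `A(u; q)`. -/
def opA {N : ℕ} (s : Fin N → ℕ) (z : Fin N → ℂ) (γ u : ℂ) : Op s := monodromy s z γ u 0 0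

/-- `B(u; q)`. -/
def opB {N : ℕ} (s : Fin N → ℕ) (z : Fin N → ℂ) (γ u : ℂ) : Op s := monodromy s z γ u 0 1

/-- `D(u; q)`. -/
def opD {N : ℕ} (s : Fin N → ℕ) (z : Fin N → ℂ) (γ u : ℂ) : Op s := monodromy s z γ u 1 1

/-- The transfer matrix `T(u) = A(u) + κ D(u)`. -/
def transferMatrix {N : ℕ} (s : Fin N → ℕ) (z : Fin N → ℂ) (κ γ u : ℂ) : Op s :=
  opA s z γ u + κ • opD s z γ u

/-- The vector `v_0 ⊗ ⋯ ⊗ v_0`. -/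
def vacuum {N : ℕ} (s : Fin N → ℕ) : Conf s → ℂ := Pi.single (fun _ => 0) 1

/-- `|t⟩ = B(t_1) ⋯ B(t_k) v_0 ⊗ ⋯ ⊗ v_0`. -/
def betheVector {N : ℕ} (s : Fin N → ℕ) (z : Fin N → ℂ) (γ : ℂ) {k : ℕ} (t : Fin k → ℂ) :
    Conf s → ℂ :=
  (List.ofFn fun a : Fin k => opB s z γ (t a)).prod.mulVec (vacuum s)

/-! ### Bethe equations -/

/-- `𝒜(u) = ∏_i (u q ^ ℓ_i - z_i q ^ (-ℓ_i))`. -/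
def vacA {N : ℕ} (s : Fin N → ℕ) (z : Fin N → ℂ) (γ u : ℂ) : ℂ :=
  ∏ i, (u * qpow γ ((s i : ℂ) / 2) - z i * qpow γ (-((s i : ℂ) / 2)))

/-- `𝒟(u) = ∏_i (u q ^ (-ℓ_i) - z_i q ^ ℓ_i)`. -/
def vacD {N : ℕ} (s : Fin N → ℕ) (z : Fin N → ℂ) (γ u : ℂ) : ℂ :=
  ∏ i, (u * qpow γ (-((s i : ℂ) / 2)) - z i * qpow γ ((s i : ℂ) / 2))

/-- The system of Bethe equations for `t_1, …, t_k`. -/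
def IsBetheSolution {N : ℕ} (s : Fin N → ℕ) (z : Fin N → ℂ) (κ γ : ℂ) {k : ℕ}
    (t : Fin k → ℂ) : Prop :=
  ∀ a, vacA s z γ (t a) * ∏ b ∈ Finset.univ.erase a, (t a - t b * qval γ ^ 2) =
    κ * vacD s z γ (t a) * ∏ b ∈ Finset.univ.erase a, (t a * qval γ ^ 2 - t b)

/-- A solution of the Bethe equations is offdiagonal if its entries are pairwise distinct. -/
def IsOffdiagonal {k : ℕ} (t : Fin k → ℂ) : Prop := ∀ a b, a ≠ b → t a ≠ t b

/-- `𝒜(u) ∏_a (u q⁻¹ - t_a q) / (u - t_a) + κ 𝒟(u) ∏_a (u q - t_a q⁻¹) / (u - t_a)`. -/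
def betheEigenvalue {N : ℕ} (s : Fin N → ℕ) (z : Fin N → ℂ) (κ γ : ℂ) {k : ℕ}
    (t : Fin k → ℂ) (u : ℂ) : ℂ :=
  vacA s z γ u * ∏ a, (u * (qval γ)⁻¹ - t a * qval γ) / (u - t a) +
    κ * vacD s z γ u * ∏ a, (u * qval γ - t a * (qval γ)⁻¹) / (u - t a)

/-! ### Roots of unity -/

/-- `γ₀ = πK / M`, so that `q₀ = e^{iπK/M}`. -/
def rootAngle (M : ℕ) (K : ℤ) : ℂ := (Real.pi : ℂ) * (K : ℂ) / (M : ℂ)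

/-- `q₀ = e^{iγ₀}`. -/
def q0 (M : ℕ) (K : ℤ) : ℂ := qval (rootAngle M K)

/-- `(q - q₀)⁻¹ B(u η^{x_1}; q) B(u q² η^{x_2}; q) ⋯ B(u q^{2M-2} η^{x_M}; q)` at `q = e^{iγ}`,
where `η = q / q₀` and `η ^ x = e^{i(γ - γ₀)x}`, the branch that tends to `1` as `q → q₀`. The
entry `x_{r+1}` is `X r`, `r = 0, …, M - 1`. -/
def regB {N : ℕ} (s : Fin N → ℕ) (z : Fin N → ℂ) (M : ℕ) (K : ℤ) (u : ℂ) (X : Fin M → ℂ)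
    (γ : ℂ) : Op s :=
  (qval γ - q0 M K)⁻¹ •
    (List.ofFn fun r : Fin M =>
      opB s z γ (u * qval γ ^ (2 * (r : ℕ)) * qpow (γ - rootAngle M K) (X r))).prod

/-- `𝔹(u; X)`, the limit of `regB` as `q → q₀`, i.e. as `γ → γ₀`, `γ ≠ γ₀`. -/
def limB {N : ℕ} (s : Fin N → ℕ) (z : Fin N → ℂ) (M : ℕ) (K : ℤ) (u : ℂ) (X : Fin M → ℂ) :
    Op s :=
  limUnder (𝓝[≠] rootAngle M K) (regB s z M K u X)

/-- `P(u) = ∏_i ∏_{r = 0}^{2ℓ_i - 1} (u - z_i q₀^{2(ℓ_i - r)})`. -/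
def polyP {N : ℕ} (s : Fin N → ℕ) (z : Fin N → ℂ) (M : ℕ) (K : ℤ) (u : ℂ) : ℂ :=
  ∏ i, ∏ r ∈ Finset.range (s i), (u - z i * q0 M K ^ ((s i : ℤ) - 2 * (r : ℤ)))

/-- `Q_n(u; t) = u^{k-n} P(u) / ∏_a (u - t_a)(u - t_a q₀²)`. -/
def funQ {N : ℕ} (s : Fin N → ℕ) (z : Fin N → ℂ) (M : ℕ) (K : ℤ) {k : ℕ} (t : Fin k → ℂ)
    (n : ℤ) (u : ℂ) : ℂ :=
  u ^ ((k : ℤ) - n) * polyP s z M K u / ∏ a, ((u - t a) * (u - t a * q0 M K ^ 2))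

/-- `F_n(u; t) = M⁻¹ ∑_{r = 0}^{M-1} Q_n(u q₀^{2r}; t)`. -/
def funF {N : ℕ} (s : Fin N → ℕ) (z : Fin N → ℂ) (M : ℕ) (K : ℤ) {k : ℕ} (t : Fin k → ℂ)
    (n : ℤ) (u : ℂ) : ℂ :=
  1 / (M : ℂ) * ∑ r ∈ Finset.range M, funQ s z M K t n (u * q0 M K ^ (2 * r))

/-- `G_n(u; t) = M⁻¹ ∑_{r = 1}^{M-1} r Q_n(u q₀^{2r}; t)`. -/
def funG {N : ℕ} (s : Fin N → ℕ) (z : Fin N → ℂ) (M : ℕ) (K : ℤ) {k : ℕ} (t : Fin k → ℂ)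
    (n : ℤ) (u : ℂ) : ℂ :=
  1 / (M : ℂ) *
    ∑ r ∈ Finset.Icc 1 (M - 1), (r : ℂ) * funQ s z M K t n (u * q0 M K ^ (2 * r))

/-- `x_r^{(n)}(u; t) = 2 (1 - r - G_n(u q₀^{2r}; t) / F_n(u; t))`, for `r = 1, …, M`. -/
def xCoord {N : ℕ} (s : Fin N → ℕ) (z : Fin N → ℂ) (M : ℕ) (K : ℤ) {k : ℕ} (t : Fin k → ℂ)
    (n : ℤ) (u : ℂ) (r : ℕ) : ℂ :=
  2 * (1 - (r : ℂ) - funG s z M K t n (u * q0 M K ^ (2 * r)) / funF s z M K t n u)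

/-- `X^{(n)}(u; t) = (x_1^{(n)}(u; t), …, x_M^{(n)}(u; t))`. -/
def xVec {N : ℕ} (s : Fin N → ℕ) (z : Fin N → ℂ) (M : ℕ) (K : ℤ) {k : ℕ} (t : Fin k → ℂ)
    (n : ℤ) (u : ℂ) : Fin M → ℂ :=
  fun r => xCoord s z M K t n u ((r : ℕ) + 1)

/-- `|||t; u⟫_n = 𝔹(u_1; X_1^{(n)}) ⋯ 𝔹(u_m; X_m^{(n)}) |t⟩`, where
`X_i^{(n)} = X^{(n)}(u_i; t)`. -/
def extBetheVector {N : ℕ} (s : Fin N → ℕ) (z : Fin N → ℂ) (M : ℕ) (K : ℤ) {k m : ℕ}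
    (t : Fin k → ℂ) (n : ℤ) (u : Fin m → ℂ) : Conf s → ℂ :=
  (List.ofFn fun i : Fin m => limB s z M K (u i) (xVec s z M K t n (u i))).prod.mulVec
    (betheVector s z (rootAngle M K) t)

end XXZ

end

/-!
# Bethe vectors with strings at a root of unity

The `L`-operators satisfy the `RTT` relation for the trigonometric `R`-matrix
(`satisfiesRTT_Lop`), hence so does the monodromy matrix (`satisfiesRTT_monodromy`). This gives the
commutativity of the operators `B` and the usual relations that move `A` or `D` past `B`. Moving `A`
or `D` past a product of operators `B` produces one wanted and several unwanted terms
(`ExchangeRel.mul_prod`); for an offdiagonal solution of the Bethe equations the unwanted terms of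
`A + κ D` on `|t⟩` cancel (`transferMatrix_mulVec_betheVector`).

At `q = q₀` the product of `B` over the string `u, u q², …, u q^{2M-2}` vanishes
(`prod_opB_string_eq_zero`). Adding one site expands this product over the `q`-binomial coefficients
of `M`, all of which vanish except the two outer ones; one of these comes with `F ^ M = 0` and the
other with the product for the shorter chain. Since the product depends smoothly on `γ`, the limit
that defines `𝔹(u; X)` exists and is proportional to the `γ`-derivative, so it is continuous in
`(u, X)` (`tendsto_regB`, `continuous_limB`).

Dividing the relation between `A` or `D` and the product over a string by `q - q₀` and letting
`q → q₀` yields `exchange_limB`: up to the factor `q₀ ^ M`, `𝔹(u; X)` commutes with `A(w)` and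
`D(w)` modulo terms in which one factor `B(u q^{2r})` of the string is replaced by `A` or `D` at the
same point, with coefficients affine in `x_r - x_{r-1}` or `x_r - x_{r+1}`. For
`X = X^{(p)}(u; t)` these coefficients are proportional to the values of `Q_p` at two neighbouring
points of the string. On the vectors in question `A(v)` and `D(v)` act by scalars up to the image
of `B(v)`; for `v = u q^{2r}` that image is annihilated by the remaining factors of the string,
because the product over the whole string is zero. What remains cancels between `A` and `κ D`, as
`Q_p` solves the difference equation `funQ_mul_vacA`. The argument needs the strings to be disjoint
from each other and from `w`; the remaining cases follow by continuity in `u`.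
-/

namespace XXZ

universe u

open Matrix Filter Topology

/-! ### The `RTT` relation -/

section Exchange

variable {R : Type*} [Ring R]

/-- The trigonometric `R`-matrix, acting on `ℂ² ⊗ ℂ²`, with spectral parameters `u`, `v`. -/
noncomputable def rMatrix (q u v : ℂ) : Matrix (Fin 2 × Fin 2) (Fin 2 × Fin 2) ℂ :=
  Matrix.of fun a b =>
    if a = b then (if a.1 = a.2 then u * q - v * q⁻¹ else u - v)
    else if a = (0, 1) ∧ b = (1, 0) then u * (q - q⁻¹)
    else if a = (1, 0) ∧ b = (0, 1) then v * (q - q⁻¹)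
    else 0

/-- The product `T₁ T'₂` of `2 × 2` matrices with noncommuting entries, acting in the first and in
the second factor of `ℂ² ⊗ ℂ²`. -/
def tensorMul (T T' : Matrix (Fin 2) (Fin 2) R) : Matrix (Fin 2 × Fin 2) (Fin 2 × Fin 2) R :=
  Matrix.of fun a b => T a.1 b.1 * T' a.2 b.2

/-- The product `T'₂ T₁`, i.e. `tensorMul` with the entries multiplied in the other order. -/
def tensorMulRev (T T' : Matrix (Fin 2) (Fin 2) R) : Matrix (Fin 2 × Fin 2) (Fin 2 × Fin 2) R :=
  Matrix.of fun a b => T' a.2 b.2 * T a.1 b.1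

theorem tensorMul_mul {T T' S S' : Matrix (Fin 2) (Fin 2) R}
    (h : ∀ i j k l, Commute (S i j) (T' k l)) :
    tensorMul (T * S) (T' * S') = tensorMul T T' * tensorMul S S' := by
  ext a b
  simp only [tensorMul, Matrix.of_apply, Matrix.mul_apply, Fintype.sum_prod_type,
    Finset.sum_mul_sum]
  refine Finset.sum_congr rfl fun i _ => Finset.sum_congr rfl fun j _ => ?_
  rw [mul_assoc, ← mul_assoc (S _ _), (h _ _ _ _).eq]
  simp only [mul_assoc]

theorem tensorMulRev_mul {T T' S S' : Matrix (Fin 2) (Fin 2) R}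
    (h : ∀ i j k l, Commute (S' i j) (T k l)) :
    tensorMulRev (T * S) (T' * S') = tensorMulRev T T' * tensorMulRev S S' := by
  ext a b
  simp only [tensorMulRev, Matrix.of_apply, Matrix.mul_apply, Fintype.sum_prod_type,
    Finset.sum_mul_sum]
  rw [Finset.sum_comm]
  refine Finset.sum_congr rfl fun i _ => Finset.sum_congr rfl fun j _ => ?_
  rw [mul_assoc, ← mul_assoc (S' _ _), (h _ _ _ _).eq]
  simp only [mul_assoc]

variable [Algebra ℂ R]

/-- The relation `R(u, v) T₁(u) T₂(v) = T₂(v) T₁(u) R(u, v)`. -/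
def SatisfiesRTT (q : ℂ) (T : ℂ → Matrix (Fin 2) (Fin 2) R) : Prop :=
  ∀ u v, (rMatrix q u v).map (algebraMap ℂ R) * tensorMul (T u) (T v) =
    tensorMulRev (T u) (T v) * (rMatrix q u v).map (algebraMap ℂ R)

theorem SatisfiesRTT.mul {q : ℂ} {T S : ℂ → Matrix (Fin 2) (Fin 2) R}
    (hT : SatisfiesRTT q T) (hS : SatisfiesRTT q S)
    (h : ∀ u v i j k l, Commute (T u i j) (S v k l)) :
    SatisfiesRTT q fun u => T u * S u := by
  intro u v
  rw [tensorMul_mul fun i j k l => (h v u k l i j).symm,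
    tensorMulRev_mul fun i j k l => (h u v k l i j).symm, ← mul_assoc, hT u v, mul_assoc, hS u v,
    mul_assoc]

theorem SatisfiesRTT.one (q : ℂ) : SatisfiesRTT q fun _ => (1 : Matrix (Fin 2) (Fin 2) R) := by
  intro u v
  have h1 : tensorMul (1 : Matrix (Fin 2) (Fin 2) R) 1 = 1 := by
    ext ⟨a, b⟩ ⟨c, d⟩
    fin_cases a <;> fin_cases b <;> fin_cases c <;> fin_cases d <;> simp [tensorMul]
  have h2 : tensorMulRev (1 : Matrix (Fin 2) (Fin 2) R) 1 = 1 := by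
    ext ⟨a, b⟩ ⟨c, d⟩
    fin_cases a <;> fin_cases b <;> fin_cases c <;> fin_cases d <;> simp [tensorMulRev]
  rw [h1, h2, mul_one, one_mul]

theorem SatisfiesRTT.const_smul {q : ℂ} {T : ℂ → Matrix (Fin 2) (Fin 2) R}
    (hT : SatisfiesRTT q T) (c : ℂ) : SatisfiesRTT q fun u => c • T u := by
  intro u v
  have h1 : tensorMul (c • T u) (c • T v) = (c * c) • tensorMul (T u) (T v) := by
    ext a b
    simp [tensorMul, smul_smul]
  have h2 : tensorMulRev (c • T u) (c • T v) = (c * c) • tensorMulRev (T u) (T v) := by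
    ext a b
    simp [tensorMulRev, smul_smul]
  rw [h1, h2, Matrix.mul_smul, Matrix.smul_mul, hT u v]

/-- The `R`-matrix is homogeneous in the spectral parameters. -/
theorem SatisfiesRTT.rescale {q : ℂ} {T : ℂ → Matrix (Fin 2) (Fin 2) R}
    (hT : SatisfiesRTT q T) {z : ℂ} (hz : z ≠ 0) : SatisfiesRTT q fun u => T (u / z) := by
  intro u v
  have h : rMatrix q u v = z • rMatrix q (u / z) (v / z) := by
    ext a b
    simp only [rMatrix, Matrix.smul_apply, Matrix.of_apply, smul_eq_mul]
    split_ifs <;> field_simp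
    simp
  have h' : (rMatrix q u v).map (algebraMap ℂ R) =
      z • (rMatrix q (u / z) (v / z)).map (algebraMap ℂ R) := by
    rw [h]
    ext a b
    rw [Matrix.map_apply, Matrix.smul_apply, Matrix.smul_apply, Matrix.map_apply, smul_eq_mul,
      map_mul, Algebra.smul_def]
  rw [h', Matrix.smul_mul, Matrix.mul_smul, hT]

/-- `A(u) B(v)` in terms of `B(v) A(u)` and `B(u) A(v)`. -/
theorem SatisfiesRTT.exchange_A_B {q : ℂ} {T : ℂ → Matrix (Fin 2) (Fin 2) R}
    (hT : SatisfiesRTT q T) (u v : ℂ) :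
    (u - v) • (T u 0 0 * T v 0 1) = (u * q⁻¹ - v * q) • (T v 0 1 * T u 0 0) +
      (v * (q - q⁻¹)) • (T u 0 1 * T v 0 0) := by
  -- the arguments are interchanged: the coefficient of `A(u) B(v)` in this entry of the relation
  -- for `(v, u)` is `v - u`
  have h := congrFun (congrFun (hT v u) (0, 0)) (1, 0)
  simp [Matrix.mul_apply, Fintype.sum_prod_type, rMatrix, tensorMul, tensorMulRev] at h
  simp only [Algebra.algebraMap_eq_smul_one, sub_mul, mul_sub, smul_mul_assoc, mul_smul_comm,
    smul_smul, one_mul, mul_one] at h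
  linear_combination (norm := module) (1 : ℂ) • h

/-- `D(u) B(v)` in terms of `B(v) D(u)` and `B(u) D(v)`; this is `exchange_A_B` with `q⁻¹` in
place of `q`. -/
theorem SatisfiesRTT.exchange_D_B {q : ℂ} {T : ℂ → Matrix (Fin 2) (Fin 2) R}
    (hT : SatisfiesRTT q T) (u v : ℂ) :
    (u - v) • (T u 1 1 * T v 0 1) = (u * q - v * q⁻¹) • (T v 0 1 * T u 1 1) +
      (v * (q⁻¹ - q)) • (T u 0 1 * T v 1 1) := by
  have h := congrFun (congrFun (hT u v) (1, 0)) (1, 1)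
  simp [Matrix.mul_apply, Fintype.sum_prod_type, rMatrix, tensorMul, tensorMulRev] at h
  simp only [Algebra.algebraMap_eq_smul_one, sub_mul, mul_sub, smul_mul_assoc, mul_smul_comm,
    smul_smul, one_mul, mul_one] at h
  linear_combination (norm := module) (1 : ℂ) • h

/-- The scalar cannot always be cancelled: it vanishes for `v = u q²`. -/
theorem SatisfiesRTT.smul_B_B {q : ℂ} {T : ℂ → Matrix (Fin 2) (Fin 2) R}
    (hT : SatisfiesRTT q T) (u v : ℂ) :
    (u * q - v * q⁻¹) • (T u 0 1 * T v 0 1) = (u * q - v * q⁻¹) • (T v 0 1 * T u 0 1) := by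
  have h := congrFun (congrFun (hT u v) (0, 0)) (1, 1)
  simp [Matrix.mul_apply, Fintype.sum_prod_type, rMatrix, tensorMul, tensorMulRev] at h
  simp only [Algebra.algebraMap_eq_smul_one, sub_mul, mul_sub, smul_mul_assoc, mul_smul_comm,
    smul_smul, one_mul, mul_one] at h
  linear_combination (norm := module) (1 : ℂ) • h

/-- The `L`-operator of `U_q(sl₂)` satisfies the `RTT` relation: only the relations between
`K = q ^ H`, `K' = q ^ (-H)` and the multiples `E`, `F` of the generators by `q - q⁻¹` matter. -/
theorem satisfiesRTT_of_quantum_sl2 {q : ℂ} (hq : q ≠ 0) {K K' E F : R}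
    (hKK : K * K' = 1) (hKK' : K' * K = 1)
    (hKF : K * F = q⁻¹ • (F * K)) (hKF' : K' * F = q • (F * K'))
    (hKE : K * E = q • (E * K)) (hKE' : K' * E = q⁻¹ • (E * K'))
    (hEF : E * F = F * E + (q - q⁻¹) • (K * K - K' * K')) :
    SatisfiesRTT q fun u => !![u • K - K', u • F; E, u • K' - K] := by
  intro u v
  ext ⟨a, b⟩ ⟨c, d⟩
  -- each of the 16 entries is brought to normal order, with `F` before `E` before `K`, `K'`
  fin_cases a <;> fin_cases b <;> fin_cases c <;> fin_cases d <;>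
  · simp only [Matrix.mul_apply, Fintype.sum_prod_type, rMatrix, tensorMul, tensorMulRev,
      Fin.sum_univ_two, Matrix.map_apply, Matrix.of_apply]
    simp
    simp only [Algebra.algebraMap_eq_smul_one, sub_mul, mul_sub,
      smul_mul_assoc, mul_smul_comm, smul_smul, smul_add, smul_sub, 
      one_mul, mul_one, hKK, hKK', hKF, hKF', hKE, hKE', hEF]
    try (match_scalars <;> field_simp <;> ring)

end Exchange

/-! ### Operators acting in one tensor factor -/

section LocalOp

variable {N : ℕ} {s : Fin N → ℕ}

theorem localOp_mulVec (i : Fin N) (X : Matrix (Fin (s i + 1)) (Fin (s i + 1)) ℂ)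
    (ψ : Conf s → ℂ) (a : Conf s) :
    (localOp s i X).mulVec ψ a = ∑ r, X (a i) r * ψ (Function.update a i r) := by
  have h : (localOp s i X).mulVec ψ a =
      ∑ b ∈ Finset.univ.filter (fun b : Conf s => ∀ j, j ≠ i → a j = b j),
        X (a i) (b i) * ψ b := by
    simp [Matrix.mulVec, dotProduct, localOp, Finset.sum_filter, ite_mul]
  rw [h]
  refine Finset.sum_bij' (fun b _ => b i) (fun r _ => Function.update a i r) (by simp) ?_ ?_
    (by simp) ?_
  · intro r _
    simp only [Finset.mem_filter, Finset.mem_univ, true_and]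
    intro j hj
    simp [hj]
  · intro b hb
    ext j
    by_cases hj : j = i
    · subst hj; simp
    · simp [hj, (Finset.mem_filter.1 hb).2 j hj]
  · intro b hb
    have : Function.update a i (b i) = b := by
      ext j
      by_cases hj : j = i
      · subst hj; simp
      · simp [hj, (Finset.mem_filter.1 hb).2 j hj]
    rw [this]

theorem op_ext {X Y : Op s} (h : ∀ ψ : Conf s → ℂ, X.mulVec ψ = Y.mulVec ψ) : X = Y :=
  Matrix.mulVec_injective (funext h)

theorem localOp_mul (i : Fin N) (X Y : Matrix (Fin (s i + 1)) (Fin (s i + 1)) ℂ) :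
    localOp s i (X * Y) = localOp s i X * localOp s i Y := by
  refine op_ext fun ψ => funext fun a => ?_
  rw [← Matrix.mulVec_mulVec]
  simp only [localOp_mulVec, Function.update_self, Function.update_idem, Matrix.mul_apply,
    Finset.sum_mul, Finset.mul_sum]
  rw [Finset.sum_comm]
  simp only [mul_assoc]

theorem localOp_one (i : Fin N) : localOp s i 1 = 1 := by
  refine op_ext fun ψ => funext fun a => ?_
  simp [localOp_mulVec, Matrix.one_apply]

theorem localOp_add (i : Fin N) (X Y : Matrix (Fin (s i + 1)) (Fin (s i + 1)) ℂ) :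
    localOp s i (X + Y) = localOp s i X + localOp s i Y := by
  ext a b
  simp only [localOp, Matrix.of_apply, Matrix.add_apply]
  split_ifs <;> simp

theorem localOp_smul (i : Fin N) (c : ℂ) (X : Matrix (Fin (s i + 1)) (Fin (s i + 1)) ℂ) :
    localOp s i (c • X) = c • localOp s i X := by
  ext a b
  simp [localOp]

/-- `localOp` as an algebra homomorphism. -/
def localHom (s : Fin N → ℕ) (i : Fin N) :
    Matrix (Fin (s i + 1)) (Fin (s i + 1)) ℂ →ₐ[ℂ] Op s :=
  AlgHom.ofLinearMap
    { toFun := localOp s i, map_add' := localOp_add i, map_smul' := localOp_smul i }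
    (localOp_one i) (localOp_mul i)

theorem localHom_apply (i : Fin N) (X : Matrix (Fin (s i + 1)) (Fin (s i + 1)) ℂ) :
    localHom s i X = localOp s i X := rfl

theorem commute_localHom {i j : Fin N} (h : i ≠ j)
    (X : Matrix (Fin (s i + 1)) (Fin (s i + 1)) ℂ) (Y : Matrix (Fin (s j + 1)) (Fin (s j + 1)) ℂ) :
    Commute (localHom s i X) (localHom s j Y) := by
  refine op_ext fun ψ => funext fun a => ?_
  rw [← Matrix.mulVec_mulVec, ← Matrix.mulVec_mulVec]
  simp only [localHom_apply, localOp_mulVec, Function.update_of_ne h, Function.update_of_ne h.symm,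
    Finset.mul_sum]
  rw [Finset.sum_comm]
  refine Finset.sum_congr rfl fun r _ => Finset.sum_congr rfl fun r' _ => ?_
  rw [Function.update_comm h, mul_left_comm]

/-- Only the column `0` of `X` acts on the vacuum. -/
theorem localHom_mulVec_vacuum (i : Fin N) {X : Matrix (Fin (s i + 1)) (Fin (s i + 1)) ℂ} {c : ℂ}
    (h : ∀ r, X r 0 = if r = 0 then c else 0) :
    (localHom s i X).mulVec (vacuum s) = c • vacuum s := by
  funext a
  rw [localHom_apply, localOp_mulVec, Finset.sum_eq_single 0]
  · rw [h]
    simp only [vacuum, Pi.single_apply, Pi.smul_apply, smul_eq_mul, funext_iff]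
    by_cases ha : a i = 0
    · have : ∀ j, Function.update a i 0 j = 0 ↔ a j = 0 := by
        intro j
        by_cases hj : j = i
        · subst hj; simp [ha]
        · simp [hj]
      simp [this, ha]
    · have : ¬ ∀ j, a j = 0 := fun h => ha (h i)
      simp [this, ha]
  · intro r _ hr
    have : Function.update a i r ≠ fun _ => 0 := fun h => hr (by simpa using congrFun h i)
    simp [vacuum, this]
  · simp

end LocalOp

/-! ### The `L`-operator satisfies the `RTT` relation -/

section QuantumGroup

theorem qpow_add (γ x y : ℂ) : qpow γ (x + y) = qpow γ x * qpow γ y := by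
  rw [qpow, qpow, qpow, ← Complex.exp_add]; ring_nf

theorem qpow_zero (γ : ℂ) : qpow γ 0 = 1 := by simp [qpow]

theorem qpow_ne_zero (γ x : ℂ) : qpow γ x ≠ 0 := Complex.exp_ne_zero _

theorem qpow_neg (γ x : ℂ) : qpow γ (-x) = (qpow γ x)⁻¹ := by
  rw [qpow, qpow, ← Complex.exp_neg]; ring_nf

theorem qval_ne_zero (γ : ℂ) : qval γ ≠ 0 := qpow_ne_zero γ 1

theorem qpow_natCast (γ : ℂ) (n : ℕ) : qpow γ n = qval γ ^ n := by
  rw [qval, qpow, qpow, ← Complex.exp_nat_mul]; ring_nf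

/-- Multiplied by `q - q⁻¹`, the `q`-number of an integer has no denominator; at `q = ±1`, where
division by `0` makes the `q`-number vanish, both sides are `0`. -/
theorem sub_inv_mul_qnum (γ : ℂ) (n : ℕ) :
    (qval γ - (qval γ)⁻¹) * qnum γ n = qpow γ n - qpow γ (-n) := by
  by_cases h : qval γ - (qval γ)⁻¹ = 0
  · rw [h, zero_mul, qpow_neg, qpow_natCast, ← inv_pow, ← sub_eq_zero.1 h, sub_self]
  · rw [qnum, mul_div_cancel₀ _ h]

/-- `(q - q⁻¹) E`. -/
noncomputable def scaledE (γ : ℂ) (s : ℕ) : Matrix (Fin (s + 1)) (Fin (s + 1)) ℂ :=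
  Matrix.of fun a b => if (a : ℕ) + 1 = (b : ℕ) then qpow γ (b : ℕ) - qpow γ (-(b : ℕ)) else 0

/-- `(q - q⁻¹) F`. -/
noncomputable def scaledF (γ : ℂ) (s : ℕ) : Matrix (Fin (s + 1)) (Fin (s + 1)) ℂ :=
  Matrix.of fun a b => if (a : ℕ) = (b : ℕ) + 1 then
    qpow γ ((s : ℂ) - (b : ℕ)) - qpow γ (-((s : ℂ) - (b : ℕ))) else 0

theorem smul_opE (γ : ℂ) (s : ℕ) : (qval γ - (qval γ)⁻¹) • opE γ s = scaledE γ s := by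
  ext a b
  simp only [opE, scaledE, Matrix.smul_apply, Matrix.of_apply, smul_eq_mul, mul_ite, mul_zero,
    sub_inv_mul_qnum]

theorem smul_opF (γ : ℂ) (s : ℕ) : (qval γ - (qval γ)⁻¹) • opF γ s = scaledF γ s := by
  ext a b
  have h : (s : ℂ) - (b : ℕ) = ((s - b : ℕ) : ℂ) := by
    rw [Nat.cast_sub (by omega)]
  simp only [opF, scaledF, Matrix.smul_apply, Matrix.of_apply, smul_eq_mul, mul_ite, mul_zero, h,
    sub_inv_mul_qnum]

theorem Lop_eq (γ : ℂ) (s : ℕ) (u : ℂ) :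
    Lop γ s u = !![u • opQH γ s 1 - opQH γ s (-1), u • scaledF γ s;
      scaledE γ s, u • opQH γ s (-1) - opQH γ s 1] := by
  rw [Lop, mul_smul, smul_opF, smul_opE]

theorem opQH_mul_neg (γ : ℂ) (s : ℕ) (σ : ℂ) : opQH γ s σ * opQH γ s (-σ) = 1 := by
  rw [opQH, opQH, Matrix.diagonal_mul_diagonal, ← Matrix.diagonal_one]
  congr 1
  ext r
  rw [← qpow_add]
  simp [qpow_zero]

theorem opQH_mul_scaledF (γ : ℂ) (s : ℕ) (σ : ℂ) :
    opQH γ s σ * scaledF γ s = qpow γ (-σ) • (scaledF γ s * opQH γ s σ) := by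
  ext a b
  simp only [opQH, scaledF, Matrix.diagonal_mul, Matrix.smul_apply, Matrix.mul_diagonal,
    Matrix.of_apply, smul_eq_mul]
  split_ifs with h
  · rw [mul_left_comm, ← qpow_add, mul_comm, h]
    congr 2
    push_cast
    ring
  · simp

theorem opQH_mul_scaledE (γ : ℂ) (s : ℕ) (σ : ℂ) :
    opQH γ s σ * scaledE γ s = qpow γ σ • (scaledE γ s * opQH γ s σ) := by
  ext a b
  simp only [opQH, scaledE, Matrix.diagonal_mul, Matrix.smul_apply, Matrix.mul_diagonal,
    Matrix.of_apply, smul_eq_mul]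
  split_ifs with h
  · rw [mul_left_comm, ← qpow_add, mul_comm, ← h]
    congr 2
    push_cast
    ring
  · simp

theorem scaledE_mul_scaledF_apply (γ : ℂ) (s : ℕ) (a b : Fin (s + 1)) :
    (scaledE γ s * scaledF γ s) a b = if a = b then
      (qpow γ (a + 1) - qpow γ (-(a + 1))) * (qpow γ (s - a) - qpow γ (-(s - a))) else 0 := by
  rw [Matrix.mul_apply]
  by_cases ha : (a : ℕ) + 1 < s + 1
  · rw [Finset.sum_eq_single ⟨a + 1, ha⟩]
    · simp only [scaledE, scaledF, Matrix.of_apply, Fin.ext_iff]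
      by_cases h : (a : ℕ) = b
      · simp [h]
      · simp [h]
    · intro c _ hc
      have : ¬ (a : ℕ) + 1 = c := fun h => hc (Fin.ext h.symm)
      simp [scaledE, this]
    · simp
  -- at the lowest vector the formula gives `0` because of the factor `[0]`
  · have has : (a : ℕ) = s := by omega
    rw [Finset.sum_eq_zero]
    · simp [has]
    · intro c _
      have : ¬ (a : ℕ) + 1 = c := by omega
      simp [scaledE, this]

theorem scaledF_mul_scaledE_apply (γ : ℂ) (s : ℕ) (a b : Fin (s + 1)) :
    (scaledF γ s * scaledE γ s) a b = if a = b then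
      (qpow γ (s - a + 1) - qpow γ (-(s - a + 1))) * (qpow γ a - qpow γ (-a)) else 0 := by
  rw [Matrix.mul_apply]
  by_cases ha : (a : ℕ) = 0
  · rw [Finset.sum_eq_zero]
    · simp [ha]
    · intro c _
      have : ¬ (a : ℕ) = c + 1 := by omega
      simp [scaledF, this]
  · have hc : ((a : ℕ) - 1) + 1 = a := by omega
    have hc' : (((a : ℕ) - 1 : ℕ) : ℂ) = a - 1 := by
      rw [Nat.cast_sub (by omega)]; simp
    rw [Finset.sum_eq_single ⟨(a : ℕ) - 1, by omega⟩]
    · simp only [scaledE, scaledF, Matrix.of_apply, Fin.ext_iff, hc, hc', if_true]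
      split_ifs with h1
      · rw [h1]
        ring_nf
      · simp
    · intro c _ hc
      have : ¬ (a : ℕ) = c + 1 := fun h => hc (Fin.ext (by simp [h]))
      simp [scaledF, this]
    · simp

/-- The relation `[E, F] = [2H]`, multiplied by `(q - q⁻¹)²`. -/
theorem scaledE_mul_scaledF (γ : ℂ) (s : ℕ) :
    scaledE γ s * scaledF γ s = scaledF γ s * scaledE γ s +
      (qval γ - (qval γ)⁻¹) • (opQH γ s 1 * opQH γ s 1 - opQH γ s (-1) * opQH γ s (-1)) := by
  ext a b
  simp only [Matrix.add_apply, scaledE_mul_scaledF_apply, scaledF_mul_scaledE_apply,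
    Matrix.smul_apply, Matrix.sub_apply, opQH, Matrix.diagonal_mul_diagonal,
    Matrix.diagonal_apply, smul_eq_mul]
  split_ifs with h
  · have h1 : qpow γ (1 * ((s : ℂ) / 2 - a)) * qpow γ (1 * ((s : ℂ) / 2 - a)) =
        qpow γ (s - a) * (qpow γ a)⁻¹ := by
      rw [← qpow_neg, ← qpow_add, ← qpow_add]; ring_nf
    have h2 : qpow γ (-1 * ((s : ℂ) / 2 - a)) * qpow γ (-1 * ((s : ℂ) / 2 - a)) =
        (qpow γ (s - a))⁻¹ * qpow γ a := by
      rw [← qpow_neg, ← qpow_add, ← qpow_add]; ring_nf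
    rw [h1, h2]
    simp only [qpow_neg, qpow_add]
    rw [show qpow γ 1 = qval γ from rfl]
    have := qpow_ne_zero γ a
    have := qpow_ne_zero γ (s - a)
    have := qval_ne_zero γ
    field_simp
    ring
  · simp

theorem satisfiesRTT_Lop (γ : ℂ) (s : ℕ) : SatisfiesRTT (qval γ) (Lop γ s) := by
  have h := satisfiesRTT_of_quantum_sl2 (R := Matrix (Fin (s + 1)) (Fin (s + 1)) ℂ)
    (qval_ne_zero γ) (opQH_mul_neg γ s 1) (by simpa using opQH_mul_neg γ s (-1))
    (by rw [opQH_mul_scaledF, qpow_neg, qval]) (by rw [opQH_mul_scaledF, neg_neg, qval])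
    (by rw [opQH_mul_scaledE, qval]) (by rw [opQH_mul_scaledE, qpow_neg, qval])
    (scaledE_mul_scaledF γ s)
  simpa only [← Lop_eq] using h

end QuantumGroup

/-! ### The monodromy matrix of a chain -/

theorem SatisfiesRTT.map {R R' : Type*} [Ring R] [Algebra ℂ R] [Ring R'] [Algebra ℂ R']
    {q : ℂ} {T : ℂ → Matrix (Fin 2) (Fin 2) R} (hT : SatisfiesRTT q T) (f : R →ₐ[ℂ] R') :
    SatisfiesRTT q fun u => (T u).map f := by
  intro u v
  have h1 : tensorMul ((T u).map f) ((T v).map f) = (tensorMul (T u) (T v)).map f := by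
    ext a b; simp [tensorMul]
  have h2 : tensorMulRev ((T u).map f) ((T v).map f) = (tensorMulRev (T u) (T v)).map f := by
    ext a b; simp [tensorMulRev]
  have h3 : (rMatrix q u v).map (algebraMap ℂ R') =
      ((rMatrix q u v).map (algebraMap ℂ R)).map f := by
    ext a b; simp
  rw [h1, h2, h3, ← Matrix.map_mul, ← Matrix.map_mul, hT u v]

section Monodromy

variable {N : ℕ} (s : Fin N → ℕ) (z : Fin N → ℂ) (γ : ℂ)

/-- `L_i(u / z_i)`, acting in the `i`-th factor of the chain. -/
noncomputable def siteL (i : Fin N) (u : ℂ) : Matrix (Fin 2) (Fin 2) (Op s) :=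
  (Lop γ (s i) (u / z i)).map (localHom s i)

/-- The ordered product of the `L`-operators of the sites in a list. -/
noncomputable def listMonodromy (l : List (Fin N)) (u : ℂ) : Matrix (Fin 2) (Fin 2) (Op s) :=
  (l.map fun i => siteL s z γ i u).prod

theorem listMonodromy_cons (i : Fin N) (l : List (Fin N)) (u : ℂ) :
    listMonodromy s z γ (i :: l) u = siteL s z γ i u * listMonodromy s z γ l u := by
  simp [listMonodromy]

theorem monodromy_eq (u : ℂ) :
    monodromy s z γ u = (∏ i, z i) • listMonodromy s z γ (List.finRange N).reverse u := by
  rw [monodromy, listMonodromy, List.ofFn_eq_map, List.map_reverse]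
  rfl

theorem commute_listMonodromy {i : Fin N} {l : List (Fin N)} (hi : i ∉ l)
    (X : Matrix (Fin (s i + 1)) (Fin (s i + 1)) ℂ) (u : ℂ) (a b : Fin 2) :
    Commute (localHom s i X) (listMonodromy s z γ l u a b) := by
  induction l generalizing a b with
  | nil =>
    simp only [listMonodromy, List.map_nil, List.prod_nil, Matrix.one_apply]
    split_ifs
    · exact Commute.one_right _
    · exact Commute.zero_right _
  | cons j l ih =>
    rw [List.mem_cons, not_or] at hi
    rw [listMonodromy_cons, Matrix.mul_apply]
    exact Commute.sum_right _ _ _ fun k _ =>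
      (commute_localHom hi.1 _ _).mul_right (ih hi.2 _ _)

theorem satisfiesRTT_listMonodromy (hz : ∀ i, z i ≠ 0) {l : List (Fin N)} (hl : l.Nodup) :
    SatisfiesRTT (qval γ) (listMonodromy s z γ l) := by
  induction l with
  | nil => exact SatisfiesRTT.one (R := Op s) (qval γ)
  | cons i l ih =>
    have h := SatisfiesRTT.mul (((satisfiesRTT_Lop γ (s i)).rescale (hz i)).map (localHom s i))
      (ih hl.of_cons) fun u v a b a' b' =>
        commute_listMonodromy s z γ hl.notMem _ _ _ _
    intro u v
    simp only [listMonodromy_cons]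
    exact h u v

theorem satisfiesRTT_monodromy (hz : ∀ i, z i ≠ 0) :
    SatisfiesRTT (qval γ) (monodromy s z γ) := by
  have h := (satisfiesRTT_listMonodromy s z γ hz
    (List.nodup_reverse.2 (List.nodup_finRange N))).const_smul (∏ i, z i)
  intro u v
  simp only [monodromy_eq]
  exact h u v

/-- At `u = 0` all `L`-operators are lower triangular. -/
theorem listMonodromy_zero_B (l : List (Fin N)) : listMonodromy s z γ l 0 0 1 = 0 := by
  induction l with
  | nil => simp [listMonodromy]
  | cons i l ih =>
    simp [listMonodromy_cons, Matrix.mul_apply, ih, siteL, Lop]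

theorem opB_zero : opB s z γ 0 = 0 := by
  simp [opB, monodromy_eq, listMonodromy_zero_B]

/-- The vacuum is annihilated by `C(u)` and is an eigenvector of `A(u)` and `D(u)`; the statement
about `C` is needed for the other two. -/
theorem listMonodromy_mulVec_vacuum {l : List (Fin N)} (hl : l.Nodup) (u : ℂ) :
    (listMonodromy s z γ l u 1 0).mulVec (vacuum s) = 0 ∧
    (listMonodromy s z γ l u 0 0).mulVec (vacuum s) =
      (l.map fun i => u / z i * qpow γ (s i / 2) - qpow γ (-(s i / 2))).prod • vacuum s ∧
    (listMonodromy s z γ l u 1 1).mulVec (vacuum s) =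
      (l.map fun i => u / z i * qpow γ (-(s i / 2)) - qpow γ (s i / 2)).prod • vacuum s := by
  induction l with
  | nil => simp [listMonodromy]
  | cons i l ih =>
    obtain ⟨hC, hA, hD⟩ := ih hl.of_cons
    have hc : (siteL s z γ i u 1 0).mulVec (vacuum s) = 0 := by
      have := localHom_mulVec_vacuum (s := s) i (X := Lop γ (s i) (u / z i) 1 0) (c := 0) (by
        intro r
        simp [Lop_eq, scaledE])
      simpa [siteL] using this
    have ha : (siteL s z γ i u 0 0).mulVec (vacuum s) =
        (u / z i * qpow γ (s i / 2) - qpow γ (-(s i / 2))) • vacuum s := by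
      refine localHom_mulVec_vacuum (s := s) i (X := Lop γ (s i) (u / z i) 0 0) fun r => ?_
      by_cases hr : r = 0 <;> simp [Lop, opQH, hr]
    have hd : (siteL s z γ i u 1 1).mulVec (vacuum s) =
        (u / z i * qpow γ (-(s i / 2)) - qpow γ (s i / 2)) • vacuum s := by
      refine localHom_mulVec_vacuum (s := s) i (X := Lop γ (s i) (u / z i) 1 1) fun r => ?_
      by_cases hr : r = 0 <;> simp [Lop, opQH, hr]
    have hcomm := (commute_listMonodromy s z γ hl.notMem (Lop γ (s i) (u / z i) 1 0) u 0 1).eq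
    refine ⟨?_, ?_, ?_⟩
    · rw [listMonodromy_cons, Matrix.mul_apply, Fin.sum_univ_two, Matrix.add_mulVec,
        ← Matrix.mulVec_mulVec, ← Matrix.mulVec_mulVec, hC, hA, Matrix.mulVec_smul, hc]
      simp
    · rw [listMonodromy_cons, Matrix.mul_apply, Fin.sum_univ_two, Matrix.add_mulVec,
        ← Matrix.mulVec_mulVec, ← Matrix.mulVec_mulVec, hC, hA, Matrix.mulVec_smul, ha]
      simp [smul_smul, mul_comm]
    · rw [listMonodromy_cons, Matrix.mul_apply, Fin.sum_univ_two, Matrix.add_mulVec]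
      rw [show siteL s z γ i u 1 0 = localHom s i (Lop γ (s i) (u / z i) 1 0) from rfl] at hc ⊢
      rw [hcomm, ← Matrix.mulVec_mulVec, ← Matrix.mulVec_mulVec, hc, hD, Matrix.mulVec_smul, hd]
      simp [smul_smul, mul_comm]

theorem prod_mul_prod_reverse_finRange (f : Fin N → ℂ) :
    (∏ i, z i) * ((List.finRange N).reverse.map f).prod = ∏ i, z i * f i := by
  rw [List.map_reverse, List.prod_reverse, ← List.ofFn_eq_map, List.prod_ofFn,
    Finset.prod_mul_distrib]

theorem opA_mulVec_vacuum (hz : ∀ i, z i ≠ 0) (u : ℂ) :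
    (opA s z γ u).mulVec (vacuum s) = vacA s z γ u • vacuum s := by
  rw [opA, monodromy_eq, Matrix.smul_apply, Matrix.smul_mulVec,
    (listMonodromy_mulVec_vacuum s z γ (List.nodup_reverse.2 (List.nodup_finRange N)) u).2.1,
    smul_smul, prod_mul_prod_reverse_finRange, vacA]
  congr 1
  refine Finset.prod_congr rfl fun i _ => ?_
  field_simp [hz i]

theorem opD_mulVec_vacuum (hz : ∀ i, z i ≠ 0) (u : ℂ) :
    (opD s z γ u).mulVec (vacuum s) = vacD s z γ u • vacuum s := by
  rw [opD, monodromy_eq, Matrix.smul_apply, Matrix.smul_mulVec,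
    (listMonodromy_mulVec_vacuum s z γ (List.nodup_reverse.2 (List.nodup_finRange N)) u).2.2,
    smul_smul, prod_mul_prod_reverse_finRange, vacD]
  congr 1
  refine Finset.prod_congr rfl fun i _ => ?_
  field_simp [hz i]

end Monodromy

/-! ### The `q`-binomial expansion of a product over a string -/

section QBinomial

/-- `∏_{i = 1}^n (q ^ i - q ^ (-i))`. -/
noncomputable def qFactorial (q : ℂ) (n : ℕ) : ℂ :=
  ∏ i ∈ Finset.range n, (q ^ (i + 1) - (q ^ (i + 1))⁻¹)

/-- The symmetric `q`-binomial coefficient of `n + j` over `j`. It is set to `1` for `n = 0` or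
`j = 0`, where the quotient of `q`-factorials can be `0 / 0` at a root of unity. -/
noncomputable def qBinomial (q : ℂ) (n j : ℕ) : ℂ :=
  if n = 0 ∨ j = 0 then 1 else qFactorial q (n + j) / (qFactorial q n * qFactorial q j)

theorem qFactorial_succ (q : ℂ) (n : ℕ) :
    qFactorial q (n + 1) = qFactorial q n * (q ^ (n + 1) - (q ^ (n + 1))⁻¹) :=
  Finset.prod_range_succ _ _

theorem qFactorial_zero (q : ℂ) : qFactorial q 0 = 1 := Finset.prod_range_zero _

theorem qBinomial_zero_left (q : ℂ) (j : ℕ) : qBinomial q 0 j = 1 := by simp [qBinomial]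

theorem qBinomial_zero_right (q : ℂ) (n : ℕ) : qBinomial q n 0 = 1 := by simp [qBinomial]

theorem qBinomial_eq {q : ℂ} {n j : ℕ} (hn : qFactorial q n ≠ 0) (hj : qFactorial q j ≠ 0) :
    qBinomial q n j = qFactorial q (n + j) / (qFactorial q n * qFactorial q j) := by
  rw [qBinomial]
  split_ifs with h
  · rcases h with rfl | rfl <;> simp [qFactorial_zero, div_self, hn, hj]
  · rfl

/-- The two forms of Pascal's rule. -/
theorem qBinomial_succ_succ {q : ℂ} (hq : q ≠ 0) {n j : ℕ} (hn : qFactorial q (n + 1) ≠ 0)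
    (hj : qFactorial q (j + 1) ≠ 0) :
    qBinomial q (n + 1) (j + 1) =
        q ^ (j + 1) * qBinomial q n (j + 1) + (q ^ (n + 1))⁻¹ * qBinomial q (n + 1) j ∧
      qBinomial q (n + 1) (j + 1) =
        (q ^ (j + 1))⁻¹ * qBinomial q n (j + 1) + q ^ (n + 1) * qBinomial q (n + 1) j := by
  have hn' := hn
  have hj' := hj
  rw [qFactorial_succ] at hn' hj'
  obtain ⟨hn1, hn2⟩ := mul_ne_zero_iff.1 hn'
  obtain ⟨hj1, hj2⟩ := mul_ne_zero_iff.1 hj'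
  rw [qBinomial_eq hn hj, qBinomial_eq hn1 hj, qBinomial_eq hn hj1,
    show n + 1 + (j + 1) = n + j + 1 + 1 by ring, show n + (j + 1) = n + j + 1 by ring,
    show n + 1 + j = n + j + 1 by ring, qFactorial_succ q (n + j + 1), qFactorial_succ q n,
    qFactorial_succ q j, show n + j + 1 + 1 = (n + 1) + (j + 1) by ring, pow_add q (n + 1) (j + 1)]
  have hx : q ^ (n + 1) ≠ 0 := pow_ne_zero _ hq
  have hy : q ^ (j + 1) ≠ 0 := pow_ne_zero _ hq
  generalize q ^ (n + 1) = x at *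
  generalize q ^ (j + 1) = y at *
  generalize qFactorial q (n + j + 1) = f at *
  generalize qFactorial q n = g at *
  generalize qFactorial q j = h at *
  have e1 : f * (x * y - (x * y)⁻¹) / (g * (x - x⁻¹) * (h * (y - y⁻¹))) =
      (x * y - (x * y)⁻¹) * (f / (g * (x - x⁻¹) * (h * (y - y⁻¹)))) := by ring
  have e2 : f / (g * (h * (y - y⁻¹))) =
      (x - x⁻¹) * (f / (g * (x - x⁻¹) * (h * (y - y⁻¹)))) := by
    generalize x - x⁻¹ = x' at *
    generalize y - y⁻¹ = y' at *
    field_simp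
  have e3 : f / (g * (x - x⁻¹) * h) =
      (y - y⁻¹) * (f / (g * (x - x⁻¹) * (h * (y - y⁻¹)))) := by
    generalize x - x⁻¹ = x' at *
    generalize y - y⁻¹ = y' at *
    field_simp
  rw [e1, e2, e3]
  generalize f / (g * (x - x⁻¹) * (h * (y - y⁻¹))) = w
  constructor <;> field_simp <;> ring

end QBinomial

section Fusion

variable {R : Type*} [Ring R]

/-- The ordered product `f 0 * f 1 * ⋯ * f (n - 1)`. -/
def rangeProd (f : ℕ → R) (n : ℕ) : R := ((List.range n).map f).prod

theorem rangeProd_zero (f : ℕ → R) : rangeProd f 0 = 1 := by simp [rangeProd]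

theorem rangeProd_succ (f : ℕ → R) (n : ℕ) : rangeProd f (n + 1) = rangeProd f n * f n := by
  simp [rangeProd, List.range_succ]

theorem commute_rangeProd {x : R} {f : ℕ → R} (h : ∀ i, Commute x (f i)) (n : ℕ) :
    Commute x (rangeProd f n) := by
  induction n with
  | zero => rw [rangeProd_zero]; exact Commute.one_right x
  | succ n ih => rw [rangeProd_succ]; exact ih.mul_right (h n)

variable [Algebra ℂ R]

/-- The relation `D_i B_{i+1} = q B_i D_{i+1}`, which holds for arguments that differ by `q²`, moves a
factor `B` to the left through a product of consecutive factors `D`. -/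
theorem rangeProd_mul_B {q : ℂ} {B D : ℕ → R}
    (hDB : ∀ i, D i * B (i + 1) = q • (B i * D (i + 1))) (n j : ℕ) :
    rangeProd (fun i => D (n + i)) j * B (n + j) =
      q ^ j • (B n * rangeProd (fun i => D (n + 1 + i)) j) := by
  induction j with
  | zero => simp [rangeProd_zero]
  | succ j ih =>
    rw [rangeProd_succ, mul_assoc, ← add_assoc, hDB, mul_smul_comm, ← mul_assoc, ih,
      smul_mul_assoc, smul_smul, ← pow_succ', rangeProd_succ, mul_assoc,
      show n + 1 + j = n + j + 1 by ring]

/-- The coefficient of `B₀ ⋯ B_{n-1} D_n ⋯ D_{n+j-1}` in the expansion of the product of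
`(x K - K') B_r + x F D_r`, `x = u q ^ (2r)`, over `r < n + j`. -/
noncomputable def fusionCoeff (q u : ℂ) (K K' F : R) (n j : ℕ) : R :=
  (qBinomial q n j * ∏ i ∈ Finset.range j, (u * q ^ (2 * (n + i)))) •
    (F ^ j * rangeProd (fun i => (u * q ^ (2 * i)) • K - K') n)

variable {q u : ℂ} {K K' F : R}

/-- `F` shifts the argument of `x K - K'` by `q⁻²`. -/
theorem smul_sub_mul_F (hq : q ≠ 0) (hKF : K * F = q⁻¹ • (F * K)) (hKF' : K' * F = q • (F * K'))
    (x : ℂ) : (x • K - K') * F = q • (F * ((x * (q ^ 2)⁻¹) • K - K')) := by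
  rw [sub_mul, smul_mul_assoc, hKF, hKF', mul_sub, mul_smul_comm]
  match_scalars
  · field_simp
  · ring

theorem commute_smul_sub (hK : Commute K K') (x y : ℂ) :
    Commute (x • K - K') (y • K - K') := by
  refine Commute.sub_left (Commute.smul_left ?_ x) ?_
  · exact ((Commute.refl K).smul_right y).sub_right hK
  · exact (hK.symm.smul_right y).sub_right (Commute.refl K')

theorem rangeProd_mul_F (hq : q ≠ 0) (hK : Commute K K') (hKF : K * F = q⁻¹ • (F * K))
    (hKF' : K' * F = q • (F * K')) (n : ℕ) :
    rangeProd (fun i => (u * q ^ (2 * i)) • K - K') (n + 1) * F =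
      q ^ (n + 1) • (F * (rangeProd (fun i => (u * q ^ (2 * i)) • K - K') n *
        ((u * (q ^ 2)⁻¹) • K - K'))) := by
  induction n with
  | zero => simp [rangeProd_succ, rangeProd_zero, smul_sub_mul_F hq hKF hKF']
  | succ n ih =>
    have h : u * q ^ (2 * (n + 1)) * (q ^ 2)⁻¹ = u * q ^ (2 * n) := by
      rw [mul_add, pow_add]; field_simp
    rw [rangeProd_succ, mul_assoc, smul_sub_mul_F hq hKF hKF', h, mul_smul_comm, ← mul_assoc, ih,
      smul_mul_assoc, smul_smul, ← pow_succ', mul_assoc, mul_assoc,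
      (commute_smul_sub hK (u * (q ^ 2)⁻¹) _).eq, rangeProd_succ, mul_assoc]

/-- The recursion for the coefficients that is produced by one more factor on the right. -/
theorem fusionCoeff_succ_succ (hq : q ≠ 0) (hK : Commute K K') (hKF : K * F = q⁻¹ • (F * K))
    (hKF' : K' * F = q • (F * K')) {n j : ℕ} (hn : qFactorial q (n + 1) ≠ 0)
    (hj : qFactorial q (j + 1) ≠ 0) :
    fusionCoeff q u K K' F (n + 1) (j + 1) =
      q ^ (j + 1) • (fusionCoeff q u K K' F n (j + 1) * ((u * q ^ (2 * (n + (j + 1)))) • K - K')) +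
        fusionCoeff q u K K' F (n + 1) j * ((u * q ^ (2 * (n + 1 + j))) • F) := by
  obtain ⟨h1, h2⟩ := qBinomial_succ_succ hq hn hj
  have hy : ∏ i ∈ Finset.range (j + 1), (u * q ^ (2 * (n + 1 + i))) =
      (q ^ (j + 1)) ^ 2 * ∏ i ∈ Finset.range (j + 1), (u * q ^ (2 * (n + i))) := by
    rw [← pow_mul, mul_comm (j + 1), pow_mul, ← Finset.card_range (j + 1), ← Finset.prod_const,
      Finset.card_range, ← Finset.prod_mul_distrib]
    exact Finset.prod_congr rfl fun i _ => by ring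
  have hy' : (∏ i ∈ Finset.range j, (u * q ^ (2 * (n + 1 + i)))) * (u * q ^ (2 * (n + 1 + j))) =
      (q ^ (j + 1)) ^ 2 * ∏ i ∈ Finset.range (j + 1), (u * q ^ (2 * (n + i))) := by
    rw [← hy, Finset.prod_range_succ]
  have e : F ^ j * rangeProd (fun i => (u * q ^ (2 * i)) • K - K') (n + 1) * F =
      q ^ (n + 1) • (F ^ (j + 1) * rangeProd (fun i => (u * q ^ (2 * i)) • K - K') n *
        ((u * (q ^ 2)⁻¹) • K - K')) := by
    rw [mul_assoc, rangeProd_mul_F hq hK hKF hKF', mul_smul_comm, pow_succ F]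
    simp only [mul_assoc]
  have e3 : fusionCoeff q u K K' F (n + 1) j * ((u * q ^ (2 * (n + 1 + j))) • F) =
      (qBinomial q (n + 1) j * ((q ^ (j + 1)) ^ 2 *
        ∏ i ∈ Finset.range (j + 1), (u * q ^ (2 * (n + i)))) * q ^ (n + 1)) •
        (F ^ (j + 1) * rangeProd (fun i => (u * q ^ (2 * i)) • K - K') n *
          ((u * (q ^ 2)⁻¹) • K - K')) := by
    rw [fusionCoeff, smul_mul_assoc, mul_smul_comm, e, smul_smul, smul_smul, ← hy']
    congr 1
    ring
  rw [e3, fusionCoeff, fusionCoeff, hy, rangeProd_succ]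
  simp only [smul_mul_assoc, mul_sub, mul_smul_comm, ← mul_assoc]
  generalize ∏ i ∈ Finset.range (j + 1), (u * q ^ (2 * (n + i))) = y
  generalize F ^ (j + 1) * rangeProd (fun i => (u * q ^ (2 * i)) • K - K') n = G
  have hx' : q ^ (n + 1) ≠ 0 := pow_ne_zero _ hq
  have hy' : q ^ (j + 1) ≠ 0 := pow_ne_zero _ hq
  match_scalars
  · have e4 : q ^ (2 * (n + (j + 1))) * q ^ 2 = (q ^ (n + 1)) ^ 2 * (q ^ (j + 1)) ^ 2 := by ring
    have e5 : q ^ (2 * n) * q ^ 2 = (q ^ (n + 1)) ^ 2 := by ring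
    rw [← eq_div_iff (pow_ne_zero 2 hq)] at e4 e5
    rw [h1, e4, e5]
    field_simp
  · rw [h2]
    field_simp
    ring

/-- Expansion of the product over a string for a chain with one more site: `x K - K'` and `x F` are
the entries of the `L`-operator of that site, `B` and `D` those of the monodromy matrix of the
shorter chain. -/
theorem rangeProd_add (hq : q ≠ 0) (hK : Commute K K') (hKF : K * F = q⁻¹ • (F * K))
    (hKF' : K' * F = q • (F * K')) {B D : ℕ → R}
    (hDB : ∀ i, D i * B (i + 1) = q • (B i * D (i + 1)))
    (hKB : ∀ i, Commute K (B i)) (hKB' : ∀ i, Commute K' (B i)) (hFB : ∀ i, Commute F (B i))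
    (hKD : ∀ i, Commute K (D i)) (hKD' : ∀ i, Commute K' (D i)) (hFD : ∀ i, Commute F (D i))
    {m : ℕ} (hm : ∀ i < m, qFactorial q i ≠ 0) :
    rangeProd (fun r => ((u * q ^ (2 * r)) • K - K') * B r + ((u * q ^ (2 * r)) • F) * D r) m =
      ∑ p ∈ Finset.HasAntidiagonal.antidiagonal m, fusionCoeff q u K K' F p.1 p.2 *
        (rangeProd B p.1 * rangeProd (fun i => D (p.1 + i)) p.2) := by
  induction m with
  | zero => simp [rangeProd_zero, fusionCoeff, qBinomial_zero_left]
  | succ m ih =>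
    set Y : ℕ → ℕ → R := fun n j => rangeProd B n * rangeProd (fun i => D (n + i)) j with hY
    -- contribution of the summand with `B_m`, and of the summand with `D_m`
    let g₁ : ℕ × ℕ → R := fun p => if p.1 = 0 then 0 else
      q ^ p.2 • (fusionCoeff q u K K' F (p.1 - 1) p.2 *
        ((u * q ^ (2 * (p.1 - 1 + p.2))) • K - K')) * Y p.1 p.2
    let g₂ : ℕ × ℕ → R := fun p => if p.2 = 0 then 0 else
      fusionCoeff q u K K' F p.1 (p.2 - 1) * ((u * q ^ (2 * (p.1 + (p.2 - 1)))) • F) * Y p.1 p.2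
    have hstep : ∀ p ∈ Finset.HasAntidiagonal.antidiagonal (m + 1),
        fusionCoeff q u K K' F p.1 p.2 * Y p.1 p.2 = g₁ p + g₂ p := by
      rintro ⟨n, j⟩ hp
      rw [Finset.HasAntidiagonal.mem_antidiagonal] at hp
      rcases n with _ | n
      · rcases j with _ | j
        · simp at hp
        · have hj : j = m := by simpa using hp
          simp only [g₁, g₂, if_true, zero_add, Nat.add_sub_cancel, Nat.succ_ne_zero, if_false]
          congr 1
          simp [fusionCoeff, qBinomial_zero_left, rangeProd_zero, smul_smul, pow_succ,
            Finset.prod_range_succ, mul_comm]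
      · rcases j with _ | j
        · simp only [g₁, g₂, if_true, add_zero, Nat.add_sub_cancel, Nat.succ_ne_zero, if_false]
          congr 1
          simp [fusionCoeff, qBinomial_zero_right, rangeProd_succ]
        · simp only [g₁, g₂, Nat.add_sub_cancel, Nat.succ_ne_zero, if_false]
          rw [← add_mul, ← fusionCoeff_succ_succ hq hK hKF hKF' (hm _ (by omega)) (hm _ (by omega))]
    rw [Finset.sum_congr rfl hstep, Finset.sum_add_distrib, Finset.Nat.sum_antidiagonal_succ,
      Finset.Nat.sum_antidiagonal_succ' (f := g₂), rangeProd_succ, ih fun i hi => hm i (by omega),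
      Finset.sum_mul]
    simp only [g₁, g₂, if_true, zero_add, Nat.add_sub_cancel, Nat.succ_ne_zero, if_false,
      ← Finset.sum_add_distrib]
    refine Finset.sum_congr rfl ?_
    rintro ⟨n, j⟩ hp
    rw [Finset.HasAntidiagonal.mem_antidiagonal] at hp
    subst hp
    simp only
    have hcomm : ∀ {x : R}, (∀ i, Commute x (B i)) → (∀ i, Commute x (D i)) →
        Y n j * x = x * Y n j := fun h₁ h₂ =>
      ((commute_rangeProd h₁ n).mul_right (commute_rangeProd (fun i => h₂ (n + i)) j)).symm.eq
    have hYB : Y n j * B (n + j) = q ^ j • Y (n + 1) j := by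
      simp only [hY]
      rw [mul_assoc, rangeProd_mul_B hDB, mul_smul_comm, ← mul_assoc, rangeProd_succ]
    have hYD : Y n j * D (n + j) = Y n (j + 1) := by
      simp only [hY]
      rw [mul_assoc, rangeProd_succ]
    have h1 : Y n j * ((u * q ^ (2 * (n + j))) • K - K') =
        ((u * q ^ (2 * (n + j))) • K - K') * Y n j :=
      hcomm (fun i => ((hKB i).smul_left _).sub_left (hKB' i))
        fun i => ((hKD i).smul_left _).sub_left (hKD' i)
    have h2 : Y n j * ((u * q ^ (2 * (n + j))) • F) = ((u * q ^ (2 * (n + j))) • F) * Y n j :=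
      hcomm (fun i => (hFB i).smul_left _) fun i => (hFD i).smul_left _
    rw [mul_add, mul_assoc, ← mul_assoc (Y n j), h1, mul_assoc _ (Y n j), hYB, mul_assoc _ (Y n j),
      ← mul_assoc (Y n j), h2, mul_assoc _ (Y n j), hYD]
    simp only [mul_smul_comm, smul_mul_assoc, mul_assoc]

/-- The inner `q`-binomial coefficients of `M` contain the factor `q ^ M - q ^ (-M)`. If it vanishes,
only the two outer terms of `rangeProd_add` are left, with the factors `B₀ ⋯ B_{M-1}` and
`F ^ M`. -/
theorem rangeProd_add_eq_zero (hq : q ≠ 0) (hK : Commute K K') (hKF : K * F = q⁻¹ • (F * K))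
    (hKF' : K' * F = q • (F * K')) {B D : ℕ → R}
    (hDB : ∀ i, D i * B (i + 1) = q • (B i * D (i + 1)))
    (hKB : ∀ i, Commute K (B i)) (hKB' : ∀ i, Commute K' (B i)) (hFB : ∀ i, Commute F (B i))
    (hKD : ∀ i, Commute K (D i)) (hKD' : ∀ i, Commute K' (D i)) (hFD : ∀ i, Commute F (D i))
    {M : ℕ} (hM : ∀ i < M, qFactorial q i ≠ 0) (hM' : qFactorial q M = 0)
    (hF : F ^ M = 0) (hB : rangeProd B M = 0) :
    rangeProd (fun r => ((u * q ^ (2 * r)) • K - K') * B r + ((u * q ^ (2 * r)) • F) * D r) M =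
      0 := by
  rw [rangeProd_add hq hK hKF hKF' hDB hKB hKB' hFB hKD hKD' hFD hM]
  refine Finset.sum_eq_zero ?_
  rintro ⟨n, j⟩ hp
  rw [Finset.HasAntidiagonal.mem_antidiagonal] at hp
  simp only at hp ⊢
  rcases n with _ | n
  · have : j = M := by simpa using hp
    simp [fusionCoeff, this, hF]
  · rcases j with _ | j
    · have : n + 1 = M := by simpa using hp
      simp [this, hB]
    · simp [fusionCoeff, qBinomial, hp, hM']

end Fusion

/-! ### Moving `A` or `D` past a product of operators `B` -/

section ExchangeProd

variable {R : Type*} [Ring R] [Algebra ℂ R]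

/-- The relation between the operators `X = A`, `D` and `B`: it holds for `A` with the given `q`
and for `D` with `q⁻¹` in place of `q`. -/
def ExchangeRel (q : ℂ) (X B : ℂ → R) : Prop :=
  ∀ u v, (u - v) • (X u * B v) = (u * q⁻¹ - v * q) • (B v * X u) + (v * (q - q⁻¹)) • (B u * X v)

/-- The coefficient of the wanted term `B(v) X(u)` in `X(u) B(v)`. -/
noncomputable def wanted (q u v : ℂ) : ℂ := (u * q⁻¹ - v * q) / (u - v)

/-- The coefficient of the unwanted term `B(u) X(v)` in `X(u) B(v)`. -/
noncomputable def unwanted (q u v : ℂ) : ℂ := v * (q - q⁻¹) / (u - v)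

theorem ExchangeRel.mul_eq {q : ℂ} {X B : ℂ → R} (h : ExchangeRel q X B) {u v : ℂ} (huv : u ≠ v) :
    X u * B v = wanted q u v • (B v * X u) + unwanted q u v • (B u * X v) := by
  have huv' : u - v ≠ 0 := sub_ne_zero.2 huv
  have h1 : X u * B v = (u - v)⁻¹ • ((u - v) • (X u * B v)) := by
    rw [smul_smul, inv_mul_cancel₀ huv', one_smul]
  rw [h1, h u v, smul_add, smul_smul, smul_smul, wanted, unwanted, div_eq_inv_mul, div_eq_inv_mul]

/-- A version of `ExchangeRel.mul_prod` in which the values of `B` come from a commutative ring,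
so that their products can be written as `Finset.prod`. -/
theorem ExchangeRel.mul_map_prod {S : Type*} [CommRing S] {q : ℂ} {X : ℂ → R}
    (φ : S →+* R) (β : ℂ → S) (h : ExchangeRel q X fun u => φ (β u))
    {ι : Type*} [DecidableEq ι] (v : ι → ℂ) (s : Finset ι) (hv : Set.InjOn v s) (w : ℂ)
    (hw : ∀ a ∈ s, w ≠ v a) :
    X w * φ (∏ a ∈ s, β (v a)) =
      (∏ a ∈ s, wanted q w (v a)) • (φ (∏ a ∈ s, β (v a)) * X w) +
      ∑ a ∈ s, (unwanted q w (v a) * ∏ b ∈ s.erase a, wanted q (v a) (v b)) •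
        (φ (β w * ∏ b ∈ s.erase a, β (v b)) * X (v a)) := by
  induction s using Finset.induction_on generalizing w with
  | empty => simp
  | insert c s hc ih =>
    have hvs : Set.InjOn v s := hv.mono (by simp)
    have hcs : ∀ a ∈ s, v c ≠ v a := fun a ha hca =>
      hc (hv (by simp) (by simp [ha]) hca ▸ ha)
    have hwc : w ≠ v c := hw c (by simp)
    have ihw := ih hvs w fun a ha => hw a (by simp [ha])
    have ihc := ih hvs (v c) hcs
    rw [Finset.prod_insert hc, map_mul, ← mul_assoc, h.mul_eq hwc, add_mul, smul_mul_assoc,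
      smul_mul_assoc, mul_assoc, mul_assoc, ihw, ihc, mul_add, mul_add, smul_add, smul_add,
      Finset.sum_insert hc, Finset.erase_insert hc, Finset.prod_insert hc]
    have key : ∀ a ∈ s, (unwanted q w (v a) * ∏ b ∈ (insert c s).erase a, wanted q (v a) (v b)) •
          (φ (β w * ∏ b ∈ (insert c s).erase a, β (v b)) * X (v a)) =
        wanted q w (v c) • (φ (β (v c)) *
          ((unwanted q w (v a) * ∏ b ∈ s.erase a, wanted q (v a) (v b)) •
            (φ (β w * ∏ b ∈ s.erase a, β (v b)) * X (v a)))) +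
        unwanted q w (v c) • (φ (β w) *
          ((unwanted q (v c) (v a) * ∏ b ∈ s.erase a, wanted q (v a) (v b)) •
            (φ (β (v c) * ∏ b ∈ s.erase a, β (v b)) * X (v a)))) := by
      intro a ha
      have hac : a ≠ c := fun e => hc (e ▸ ha)
      have hc' : c ∉ s.erase a := fun e => hc (Finset.mem_of_mem_erase e)
      have hwa : w - v a ≠ 0 := sub_ne_zero.2 (hw a (by simp [ha]))
      have hwc' : w - v c ≠ 0 := sub_ne_zero.2 hwc
      have hca : v c - v a ≠ 0 := sub_ne_zero.2 (hcs a ha)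
      have hac' : v a - v c ≠ 0 := sub_ne_zero.2 (hcs a ha).symm
      -- the contribution `X(w) → X(v a)` directly and the one by way of `X(v c)` add up
      have hscal : unwanted q w (v a) * wanted q (v a) (v c) =
          wanted q w (v c) * unwanted q w (v a) + unwanted q w (v c) * unwanted q (v c) (v a) := by
        have : wanted q (v a) (v c) = (v c * q - v a * q⁻¹) / (v c - v a) := by
          rw [wanted, ← neg_div_neg_eq]; ring_nf
        rw [this]
        simp only [wanted, unwanted]
        generalize q⁻¹ = q'
        field_simp
        ring
      rw [Finset.erase_insert_of_ne hac.symm, Finset.prod_insert hc', Finset.prod_insert hc',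
        ← mul_assoc, hscal]
      simp only [mul_smul_comm, smul_smul, ← mul_assoc, ← map_mul]
      rw [show β w * β (v c) * ∏ b ∈ s.erase a, β (v b) =
        β (v c) * β w * ∏ b ∈ s.erase a, β (v b) by ring, add_mul, add_smul]
    rw [Finset.sum_congr rfl key, Finset.sum_add_distrib]
    simp only [Finset.mul_sum, Finset.smul_sum, mul_smul_comm, smul_smul, map_mul, mul_assoc]
    abel

open scoped IsMulCommutative in
/-- Commuting operators are the images of elements of a commutative ring, namely of the subalgebra
that they generate. -/
theorem exists_commRing_lift {R : Type u} [Ring R] [Algebra ℂ R] {B : ℂ → R}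
    (hB : ∀ u v, Commute (B u) (B v)) :
    ∃ (S : Type u) (_ : CommRing S) (φ : S →+* R) (β : ℂ → S), ∀ u, φ (β u) = B u := by
  have : IsMulCommutative (Algebra.adjoin ℂ (Set.range B)) :=
    Algebra.isMulCommutative_adjoin ℂ (by
      rintro _ ⟨a, rfl⟩ _ ⟨b, rfl⟩
      exact hB a b)
  exact ⟨Algebra.adjoin ℂ (Set.range B), inferInstance,
    (Algebra.adjoin ℂ (Set.range B)).val.toRingHom,
    fun u => ⟨B u, Algebra.subset_adjoin ⟨u, rfl⟩⟩, fun u => rfl⟩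

/-- `X(w) B(v_1) ⋯ B(v_n)` for pairwise distinct `v_i`, written as the wanted term and `n` unwanted
terms. In the `r`-th unwanted term the factor `B(v_r)` of the product is replaced by `1`. -/
theorem ExchangeRel.mul_prod {q : ℂ} {X B : ℂ → R} (h : ExchangeRel q X B)
    (hB : ∀ u v, Commute (B u) (B v)) {n : ℕ} {v : Fin n → ℂ} (hv : Function.Injective v) {w : ℂ}
    (hw : ∀ a, w ≠ v a) :
    X w * (List.ofFn fun a => B (v a)).prod =
      (∏ a, wanted q w (v a)) • ((List.ofFn fun a => B (v a)).prod * X w) +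
      ∑ r, (unwanted q w (v r) * ∏ a ∈ Finset.univ.erase r, wanted q (v r) (v a)) •
        (B w * (List.ofFn fun a => if a = r then 1 else B (v a)).prod * X (v r)) := by
  obtain ⟨S, _, φ, β, hφ⟩ := exists_commRing_lift hB
  have h1 : φ (∏ a, β (v a)) = (List.ofFn fun a => B (v a)).prod := by
    rw [← List.prod_ofFn, map_list_prod, List.map_ofFn]
    exact congrArg _ (congrArg _ (funext fun a => hφ (v a)))
  have h2 : ∀ r, φ (∏ a ∈ Finset.univ.erase r, β (v a)) =
      (List.ofFn fun a => if a = r then 1 else B (v a)).prod := by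
    intro r
    have : ∏ a ∈ Finset.univ.erase r, β (v a) = ∏ a, if a = r then 1 else β (v a) := by
      rw [← Finset.mul_prod_erase Finset.univ _ (Finset.mem_univ r), if_pos rfl, one_mul]
      exact Finset.prod_congr rfl fun a ha => (if_neg (Finset.ne_of_mem_erase ha)).symm
    rw [this, ← List.prod_ofFn, map_list_prod, List.map_ofFn]
    congr 2
    funext a
    simp only [Function.comp_apply, apply_ite φ, map_one, hφ]
  have := ExchangeRel.mul_map_prod φ β (by simpa only [hφ] using h) v Finset.univ hv.injOn w fun a _ => hw a
  simpa only [map_mul, h1, h2, hφ] using this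

theorem prod_ofFn_ite_mul {B : ℂ → R} (hB : ∀ u v, Commute (B u) (B v)) {n : ℕ} (v : Fin n → ℂ)
    (r : Fin n) :
    (List.ofFn fun a => if a = r then 1 else B (v a)).prod * B (v r) =
      (List.ofFn fun a => B (v a)).prod := by
  obtain ⟨S, _, φ, β, hφ⟩ := exists_commRing_lift hB
  have h1 : (List.ofFn fun a => B (v a)).prod = φ (∏ a, β (v a)) := by
    rw [← List.prod_ofFn, map_list_prod, List.map_ofFn]
    exact congrArg _ (congrArg _ (funext fun a => (hφ (v a)).symm))
  have h2 : (List.ofFn fun a => if a = r then 1 else B (v a)).prod =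
      φ (∏ a, if a = r then 1 else β (v a)) := by
    rw [← List.prod_ofFn, map_list_prod, List.map_ofFn]
    congr 2
    funext a
    simp only [Function.comp_apply, apply_ite φ, map_one, hφ]
  rw [h1, h2, ← hφ (v r), ← map_mul, ← Finset.mul_prod_erase Finset.univ _ (Finset.mem_univ r),
    ← Finset.mul_prod_erase Finset.univ (fun a => β (v a)) (Finset.mem_univ r), if_pos rfl,
    one_mul, mul_comm]
  congr 2
  exact Finset.prod_congr rfl fun a ha => if_neg (Finset.ne_of_mem_erase ha)

end ExchangeProd

/-! ### The product of `B` over a string vanishes at a root of unity -/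

section RootOfUnity

variable {M : ℕ} {K : ℤ}

theorem q0_ne_zero : q0 M K ≠ 0 := qval_ne_zero _

theorem isPrimitiveRoot_q0_sq (hM : M ≠ 0) (hK : IsCoprime K (M : ℤ)) :
    IsPrimitiveRoot (q0 M K ^ 2) M := by
  have h := Complex.isPrimitiveRoot_exp_of_isCoprime K M hM hK
  have e : q0 M K ^ 2 = Complex.exp (2 * Real.pi * Complex.I * (K / M)) := by
    rw [q0, qval, qpow, ← Complex.exp_nat_mul, rootAngle]
    congr 1
    push_cast
    ring
  rwa [e]

theorem q0_pow_sub_inv {n : ℕ} : q0 M K ^ n - (q0 M K ^ n)⁻¹ = 0 ↔ (q0 M K ^ 2) ^ n = 1 := by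
  have h : q0 M K ^ n ≠ 0 := pow_ne_zero _ q0_ne_zero
  rw [sub_eq_zero, ← mul_eq_one_iff_eq_inv₀ h, ← pow_add, ← pow_mul, two_mul]

theorem qFactorial_q0_ne_zero (hM : M ≠ 0) (hK : IsCoprime K (M : ℤ)) {n : ℕ} (hn : n < M) :
    qFactorial (q0 M K) n ≠ 0 := by
  rw [qFactorial, Finset.prod_ne_zero_iff]
  intro i hi h
  rw [q0_pow_sub_inv] at h
  exact (isPrimitiveRoot_q0_sq hM hK).pow_ne_one_of_pos_of_lt i.succ_ne_zero
    (by have := Finset.mem_range.1 hi; omega) h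

theorem qFactorial_q0_eq_zero (hM : M ≠ 0) (hK : IsCoprime K (M : ℤ)) :
    qFactorial (q0 M K) M = 0 := by
  refine Finset.prod_eq_zero (Finset.mem_range.2 (Nat.sub_one_lt hM)) ?_
  rw [q0_pow_sub_inv, Nat.sub_add_cancel (Nat.pos_of_ne_zero hM)]
  exact (isPrimitiveRoot_q0_sq hM hK).pow_eq_one

theorem scaledF_pow_apply (γ : ℂ) (s n : ℕ) (a b : Fin (s + 1)) :
    (scaledF γ s ^ n) a b = if (a : ℕ) = b + n then
      ∏ i ∈ Finset.range n, (qpow γ ((s : ℂ) - (b + i : ℕ)) - qpow γ (-((s : ℂ) - (b + i : ℕ))))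
      else 0 := by
  induction n generalizing a with
  | zero => simp [Matrix.one_apply, Fin.ext_iff]
  | succ n ih =>
    rw [pow_succ', Matrix.mul_apply]
    simp only [ih]
    by_cases h : (a : ℕ) = b + (n + 1)
    · rw [if_pos h, Finset.sum_eq_single ⟨b + n, by omega⟩, Finset.prod_range_succ, mul_comm]
      · simp [scaledF, h, add_assoc]
      · intro c _ hc
        have : ¬ (c : ℕ) = b + n := fun e => hc (Fin.ext e)
        simp [this]
      · simp
    · rw [if_neg h]
      refine Finset.sum_eq_zero fun c _ => ?_
      by_cases hc : (c : ℕ) = b + n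
      · have : ¬ (a : ℕ) = c + 1 := by omega
        simp [scaledF, this]
      · simp [hc]

/-- `F ^ M = 0`: among `M` consecutive `q`-numbers one vanishes. -/
theorem scaledF_pow_eq_zero (hM : M ≠ 0) (hK : IsCoprime K (M : ℤ)) (s : ℕ) :
    scaledF (rootAngle M K) s ^ M = 0 := by
  ext a b
  rw [scaledF_pow_apply]
  split_ifs with h
  · have hlt : (s - b) % M < M := Nat.mod_lt _ (Nat.pos_of_ne_zero hM)
    refine Finset.prod_eq_zero (Finset.mem_range.2 hlt) ?_
    have hle : (s - b) % M ≤ s - b := Nat.mod_le _ _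
    have e : (s : ℂ) - (b + (s - b) % M : ℕ) = ((M * ((s - b) / M) : ℕ) : ℂ) := by
      rw [← Nat.cast_sub (by omega)]
      congr 1
      have := Nat.mod_add_div (s - b) M
      omega
    rw [e, qpow_neg, qpow_natCast]
    change q0 M K ^ _ - (q0 M K ^ _)⁻¹ = 0
    rw [q0_pow_sub_inv, pow_mul, (isPrimitiveRoot_q0_sq hM hK).pow_eq_one, one_pow]
  · rfl

variable {N : ℕ} (s : Fin N → ℕ) (z : Fin N → ℂ)

/-- Induction on the sites by `rangeProd_add_eq_zero`. -/
theorem rangeProd_listMonodromy_B (hz : ∀ i, z i ≠ 0) (hM : 1 < M) (hK : IsCoprime K (M : ℤ))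
    {l : List (Fin N)} (hl : l.Nodup) {u : ℂ} (hu : u ≠ 0) :
    rangeProd (fun r => listMonodromy s z (rootAngle M K) l (u * q0 M K ^ (2 * r)) 0 1) M = 0 := by
  have hM0 : M ≠ 0 := by omega
  have hq1 : q0 M K ^ 2 ≠ 1 := (isPrimitiveRoot_q0_sq hM0 hK).ne_one hM
  have hq := q0_ne_zero (M := M) (K := K)
  induction l with
  | nil =>
    obtain ⟨M, rfl⟩ := Nat.exists_eq_succ_of_ne_zero hM0
    simp [rangeProd_succ, listMonodromy]
  | cons i l ih =>
    set γ := rootAngle M K with hγ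
    have hqγ : qval γ = q0 M K := rfl
    have hcomm := fun X v a b => commute_listMonodromy s z γ hl.notMem X v a b
    have hKK : Commute (opQH γ (s i) 1) (opQH γ (s i) (-1)) := by
      have h1 := opQH_mul_neg γ (s i) 1
      have h2 := opQH_mul_neg γ (s i) (-1)
      rw [neg_neg] at h2
      exact h1.trans h2.symm
    have hKF := opQH_mul_scaledF γ (s i) 1
    have hKF' := opQH_mul_scaledF γ (s i) (-1)
    rw [qpow_neg] at hKF
    rw [neg_neg] at hKF'
    have hDB : ∀ r : ℕ, listMonodromy s z γ l (u * q0 M K ^ (2 * r)) 1 1 *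
        listMonodromy s z γ l (u * q0 M K ^ (2 * (r + 1))) 0 1 = q0 M K •
        (listMonodromy s z γ l (u * q0 M K ^ (2 * r)) 0 1 *
          listMonodromy s z γ l (u * q0 M K ^ (2 * (r + 1))) 1 1) := by
      intro r
      have h := (satisfiesRTT_listMonodromy s z γ hz hl.of_cons).exchange_D_B
        (u * q0 M K ^ (2 * r)) (u * q0 M K ^ (2 * (r + 1)))
      have e1 : u * q0 M K ^ (2 * r) * qval γ - u * q0 M K ^ (2 * (r + 1)) * (qval γ)⁻¹ = 0 := by
        rw [hqγ]; field_simp; ring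
      have e2 : u * q0 M K ^ (2 * (r + 1)) * ((qval γ)⁻¹ - qval γ) =
          (u * q0 M K ^ (2 * r) - u * q0 M K ^ (2 * (r + 1))) * q0 M K := by
        rw [hqγ]; field_simp; ring
      have e3 : u * q0 M K ^ (2 * r) - u * q0 M K ^ (2 * (r + 1)) ≠ 0 := by
        have : u * q0 M K ^ (2 * r) - u * q0 M K ^ (2 * (r + 1)) =
          u * q0 M K ^ (2 * r) * (1 - q0 M K ^ 2) := by ring
        rw [this]
        exact mul_ne_zero (mul_ne_zero hu (pow_ne_zero _ hq)) (sub_ne_zero.2 hq1.symm)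
      rw [e1, e2, zero_smul, zero_add, mul_smul] at h
      exact smul_right_injective _ e3 h
    have h := rangeProd_add_eq_zero (u := u / z i) (K := localHom s i (opQH γ (s i) 1))
      (K' := localHom s i (opQH γ (s i) (-1))) (F := localHom s i (scaledF γ (s i)))
      (B := fun r => listMonodromy s z γ l (u * q0 M K ^ (2 * r)) 0 1)
      (D := fun r => listMonodromy s z γ l (u * q0 M K ^ (2 * r)) 1 1) hq
      (hKK.map (localHom s i)) (by rw [← map_mul, hKF, map_smul, map_mul]; rfl)
      (by rw [← map_mul, hKF', map_smul, map_mul]; rfl) hDB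
      (fun r => hcomm _ _ _ _) (fun r => hcomm _ _ _ _) (fun r => hcomm _ _ _ _)
      (fun r => hcomm _ _ _ _) (fun r => hcomm _ _ _ _) (fun r => hcomm _ _ _ _)
      (fun n hn => qFactorial_q0_ne_zero hM0 hK hn) (qFactorial_q0_eq_zero hM0 hK)
      (by rw [← map_pow, scaledF_pow_eq_zero hM0 hK, map_zero]) (ih hl.of_cons)
    rw [← h]
    congr 1
    funext r
    rw [listMonodromy_cons, Matrix.mul_apply, Fin.sum_univ_two]
    simp only [siteL, Lop_eq, Matrix.map_apply]
    simp [mul_div_right_comm]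

/-- At `q = q₀` the product of operators `B` over a string of length `M` vanishes. -/
theorem prod_opB_string_eq_zero (hz : ∀ i, z i ≠ 0) (hM : 1 < M) (hK : IsCoprime K (M : ℤ))
    (u : ℂ) :
    (List.ofFn fun r : Fin M => opB s z (rootAngle M K) (u * q0 M K ^ (2 * (r : ℕ)))).prod = 0 := by
  have hM0 : M ≠ 0 := by omega
  rcases eq_or_ne u 0 with rfl | hu
  · obtain ⟨M, rfl⟩ := Nat.exists_eq_succ_of_ne_zero hM0
    simp [opB_zero]
  · have h := rangeProd_listMonodromy_B s z hz hM hK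
      (List.nodup_reverse.2 (List.nodup_finRange N)) hu
    have e : ∀ (n : ℕ) (c : ℂ) (f : ℕ → Op s),
        (List.ofFn fun r : Fin n => c • f r).prod = c ^ n • rangeProd f n := by
      intro n c f
      induction n with
      | zero => simp [rangeProd_zero]
      | succ n ih =>
        rw [List.ofFn_succ', List.concat_eq_append, List.prod_append, rangeProd_succ]
        simp only [Fin.val_castSucc, ih]
        simp [smul_smul, pow_succ, mul_comm]
    simp only [opB, monodromy_eq, Matrix.smul_apply]
    rw [e M _ fun r => listMonodromy s z (rootAngle M K) (List.finRange N).reverse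
      (u * q0 M K ^ (2 * r)) 0 1, h, smul_zero]

end RootOfUnity

/-! ### Existence of the limit and its dependence on the parameters -/

section Smooth

variable {E : Type*} [NormedAddCommGroup E] [NormedSpace ℂ E]

/-- Continuous differentiability of all entries of a matrix; it is used instead of a choice of a
norm on matrices. -/
def SmoothEntries {m n : Type*} (f : E → Matrix m n ℂ) : Prop :=
  ∀ a b, ContDiff ℂ 1 fun x => f x a b

theorem SmoothEntries.mul {m n o : Type*} [Fintype n] {f : E → Matrix m n ℂ}
    {g : E → Matrix n o ℂ} (hf : SmoothEntries f) (hg : SmoothEntries g) :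
    SmoothEntries fun x => f x * g x := by
  intro a b
  simp only [Matrix.mul_apply]
  exact ContDiff.sum fun c _ => (hf a c).mul (hg c b)

theorem SmoothEntries.prod_ofFn {m : Type*} [Fintype m] [DecidableEq m] {n : ℕ}
    {f : Fin n → E → Matrix m m ℂ} (hf : ∀ i, SmoothEntries (f i)) :
    SmoothEntries fun x => (List.ofFn fun i => f i x).prod := by
  induction n with
  | zero =>
    intro a b
    simpa using contDiff_const
  | succ n ih =>
    simp only [List.ofFn_succ, List.prod_cons]
    exact (hf 0).mul (ih fun i => hf i.succ)

theorem SmoothEntries.continuous {m n : Type*} {f : E → Matrix m n ℂ} (hf : SmoothEntries f) :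
    Continuous f :=
  continuous_matrix fun a b => (hf a b).continuous

theorem contDiff_qpow {f g : E → ℂ} (hf : ContDiff ℂ 1 f) (hg : ContDiff ℂ 1 g) :
    ContDiff ℂ 1 fun x => qpow (f x) (g x) := by
  unfold qpow
  fun_prop

variable {N : ℕ} (s : Fin N → ℕ) (z : Fin N → ℂ) {g u : E → ℂ}

theorem smoothEntries_Lop (n : ℕ) (hg : ContDiff ℂ 1 g) (hu : ContDiff ℂ 1 u) (i j : Fin 2) :
    SmoothEntries fun x => Lop (g x) n (u x) i j := by
  intro a b
  have hq : ∀ c : ℂ, ContDiff ℂ 1 fun x => qpow (g x) c := fun c => contDiff_qpow hg contDiff_const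
  have h0 : ∀ σ : ℂ, ContDiff ℂ 1 fun x => opQH (g x) n σ a b := by
    intro σ
    simp only [opQH, Matrix.diagonal_apply]
    split_ifs
    · exact hq _
    · exact contDiff_const
  have hE : ContDiff ℂ 1 fun x => scaledE (g x) n a b := by
    simp only [scaledE, Matrix.of_apply]
    split_ifs
    · exact (hq _).sub (hq _)
    · exact contDiff_const
  have hF : ContDiff ℂ 1 fun x => scaledF (g x) n a b := by
    simp only [scaledF, Matrix.of_apply]
    split_ifs
    · exact (hq _).sub (hq _)
    · exact contDiff_const
  simp only [Lop_eq]
  fin_cases i <;> fin_cases j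
  · exact (hu.mul (h0 _)).sub (h0 _)
  · exact hu.mul hF
  · exact hE
  · exact (hu.mul (h0 _)).sub (h0 _)

theorem smoothEntries_listMonodromy (hg : ContDiff ℂ 1 g) (hu : ContDiff ℂ 1 u)
    (l : List (Fin N)) (i j : Fin 2) :
    SmoothEntries fun x => listMonodromy s z (g x) l (u x) i j := by
  induction l generalizing i j with
  | nil =>
    intro a b
    exact contDiff_const
  | cons k l ih =>
    have hsite : ∀ i j, SmoothEntries fun x => siteL s z (g x) k (u x) i j := by
      intro i j a b
      simp only [siteL, Matrix.map_apply, localHom_apply, localOp, Matrix.of_apply]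
      split_ifs
      · exact smoothEntries_Lop (s k) hg (hu.div_const _) i j _ _
      · exact contDiff_const
    simp only [listMonodromy_cons, Matrix.mul_apply]
    intro a b
    simp only [Matrix.sum_apply]
    exact ContDiff.sum fun c _ => (hsite i c).mul (ih c j) a b

theorem smoothEntries_monodromy (hg : ContDiff ℂ 1 g) (hu : ContDiff ℂ 1 u) (i j : Fin 2) :
    SmoothEntries fun x => monodromy s z (g x) (u x) i j := by
  intro a b
  simp only [monodromy_eq, Matrix.smul_apply]
  exact contDiff_const.mul (smoothEntries_listMonodromy s z hg hu _ i j a b)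

end Smooth

section Limit

variable {N : ℕ} (s : Fin N → ℕ) (z : Fin N → ℂ) (M : ℕ) (K : ℤ)

/-- The product `B(u η^{x_1}; q) B(u q² η^{x_2}; q) ⋯ B(u q^{2M-2} η^{x_M}; q)` as a function of
`(γ, u, X)`. -/
noncomputable def stringB (p : ℂ × ℂ × (Fin M → ℂ)) : Op s :=
  (List.ofFn fun r : Fin M => opB s z p.1
    (p.2.1 * qval p.1 ^ (2 * (r : ℕ)) * qpow (p.1 - rootAngle M K) (p.2.2 r))).prod

theorem smoothEntries_stringB : SmoothEntries (stringB s z M K) := by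
  unfold stringB opB
  refine SmoothEntries.prod_ofFn fun r => smoothEntries_monodromy s z contDiff_fst ?_ 0 1
  have h1 : ContDiff ℂ 1 fun p : ℂ × ℂ × (Fin M → ℂ) => qval p.1 :=
    contDiff_qpow contDiff_fst contDiff_const
  have h2 : ContDiff ℂ 1 fun p : ℂ × ℂ × (Fin M → ℂ) => qpow (p.1 - rootAngle M K) (p.2.2 r) :=
    contDiff_qpow (by fun_prop) (by fun_prop)
  exact ((by fun_prop : ContDiff ℂ 1 fun p : ℂ × ℂ × (Fin M → ℂ) => p.2.1).mul (h1.pow _)).mul h2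

theorem hasDerivAt_qpow (γ x : ℂ) :
    HasDerivAt (fun γ => qpow γ x) (Complex.I * x * qpow γ x) γ := by
  have h : HasDerivAt (fun γ : ℂ => Complex.I * γ * x) (Complex.I * x) γ := by
    simpa using ((hasDerivAt_id γ).const_mul Complex.I).mul_const x
  simpa [qpow, mul_comm] using h.cexp

variable {M K}

/-- A function of `γ` that vanishes at `γ₀`, divided by `q - q₀`. -/
theorem tendsto_inv_sub_mul {f : ℂ → ℂ} {f' : ℂ} (hf : HasDerivAt f f' (rootAngle M K))
    (h0 : f (rootAngle M K) = 0) :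
    Tendsto (fun γ => (qval γ - q0 M K)⁻¹ * f γ) (𝓝[≠] rootAngle M K)
      (𝓝 ((Complex.I * q0 M K)⁻¹ * f')) := by
  have hq : HasDerivAt qval (Complex.I * q0 M K) (rootAngle M K) := by
    have h := hasDerivAt_qpow (rootAngle M K) 1
    rwa [mul_one] at h
  have hne : Complex.I * q0 M K ≠ 0 := mul_ne_zero Complex.I_ne_zero q0_ne_zero
  refine (((hasDerivAt_iff_tendsto_slope.1 hq).inv₀ hne).mul
    (hasDerivAt_iff_tendsto_slope.1 hf)).congr' ?_
  filter_upwards [self_mem_nhdsWithin] with γ hγ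
  have hγ' : γ - rootAngle M K ≠ 0 := sub_ne_zero.2 hγ
  rw [slope_def_field, slope_def_field, h0, sub_zero, inv_div,
    show qval (rootAngle M K) = q0 M K from rfl]
  field_simp

theorem stringB_rootAngle (hz : ∀ i, z i ≠ 0) (hM : 1 < M) (hK : IsCoprime K (M : ℤ)) (u : ℂ)
    (X : Fin M → ℂ) : stringB s z M K (rootAngle M K, u, X) = 0 := by
  rw [← prod_opB_string_eq_zero s z hz hM hK u]
  simp [stringB, qpow, q0]

/-- The limit that defines `𝔹(u; X)` is the partial derivative of `stringB` with respect to `γ`,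
divided by `dq/dγ = i q₀`. -/
theorem tendsto_regB_fderiv (hz : ∀ i, z i ≠ 0) (hM : 1 < M) (hK : IsCoprime K (M : ℤ)) (u : ℂ)
    (X : Fin M → ℂ) :
    Tendsto (regB s z M K u X) (𝓝[≠] rootAngle M K)
      (𝓝 (Matrix.of fun a b => (Complex.I * q0 M K)⁻¹ *
        fderiv ℂ (fun p => stringB s z M K p a b) (rootAngle M K, u, X) (1, 0))) := by
  refine tendsto_pi_nhds.2 fun a => tendsto_pi_nhds.2 fun b => ?_
  have h1 : HasDerivAt (fun γ : ℂ => (γ, u, X)) (1, 0) (rootAngle M K) :=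
    (hasDerivAt_id _).prodMk (hasDerivAt_const _ _)
  have h2 := ((smoothEntries_stringB s z M K a b).differentiable one_ne_zero
    (rootAngle M K, u, X)).hasFDerivAt.comp_hasDerivAt (rootAngle M K) h1
  exact tendsto_inv_sub_mul h2
    (congrFun (congrFun (stringB_rootAngle s z hz hM hK u X) a) b)

theorem limB_eq_fderiv (hz : ∀ i, z i ≠ 0) (hM : 1 < M) (hK : IsCoprime K (M : ℤ)) (u : ℂ)
    (X : Fin M → ℂ) :
    limB s z M K u X = Matrix.of fun a b => (Complex.I * q0 M K)⁻¹ *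
        fderiv ℂ (fun p => stringB s z M K p a b) (rootAngle M K, u, X) (1, 0) :=
  (tendsto_regB_fderiv s z hz hM hK u X).limUnder_eq

theorem tendsto_regB (hz : ∀ i, z i ≠ 0) (hM : 1 < M) (hK : IsCoprime K (M : ℤ)) (u : ℂ)
    (X : Fin M → ℂ) :
    Tendsto (regB s z M K u X) (𝓝[≠] rootAngle M K) (𝓝 (limB s z M K u X)) := by
  rw [limB_eq_fderiv s z hz hM hK]
  exact tendsto_regB_fderiv s z hz hM hK u X

theorem continuous_limB (hz : ∀ i, z i ≠ 0) (hM : 1 < M) (hK : IsCoprime K (M : ℤ)) :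
    Continuous fun p : ℂ × (Fin M → ℂ) => limB s z M K p.1 p.2 := by
  simp only [limB_eq_fderiv s z hz hM hK]
  refine continuous_matrix fun a b => continuous_const.mul ?_
  have h := ((smoothEntries_stringB s z M K a b).continuous_fderiv one_ne_zero).comp
    (by fun_prop : Continuous fun p : ℂ × (Fin M → ℂ) => (rootAngle M K, p.1, p.2))
  exact h.clm_apply continuous_const

theorem limB_zero (hz : ∀ i, z i ≠ 0) (hM : 1 < M) (hK : IsCoprime K (M : ℤ)) (X : Fin M → ℂ) :
    limB s z M K 0 X = 0 := by
  refine tendsto_nhds_unique (tendsto_regB s z hz hM hK 0 X) ?_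
  have : regB s z M K 0 X = fun _ => 0 := by
    funext γ
    obtain ⟨M, rfl⟩ := Nat.exists_eq_succ_of_ne_zero (show M ≠ 0 by omega)
    simp [regB, opB_zero]
  rw [this]
  exact tendsto_const_nhds

theorem commute_opB (hz : ∀ i, z i ≠ 0) (γ u v : ℂ) : Commute (opB s z γ u) (opB s z γ v) := by
  have hq := qval_ne_zero γ
  -- the scalar in `smul_B_B` can be cancelled for `v ≠ u q²`; both sides are continuous in `v`
  have hdense : Dense ({u * qval γ ^ 2}ᶜ : Set ℂ) := dense_compl_singleton _
  have hc : Continuous fun v => opB s z γ v :=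
    (smoothEntries_monodromy s z contDiff_const contDiff_id 0 1).continuous
  have h : (fun v => opB s z γ u * opB s z γ v) = fun v => opB s z γ v * opB s z γ u := by
    refine Continuous.ext_on hdense (continuous_const.mul hc) (hc.mul continuous_const) ?_
    intro v hv
    have hne : u * qval γ - v * (qval γ)⁻¹ ≠ 0 := by
      intro h
      refine hv ?_
      rw [Set.mem_singleton_iff]
      field_simp at h
      linear_combination -h
    exact smul_right_injective _ hne ((satisfiesRTT_monodromy s z γ hz).smul_B_B u v)
  exact congrFun h v

theorem commute_opB_limB (hz : ∀ i, z i ≠ 0) (hM : 1 < M) (hK : IsCoprime K (M : ℤ)) (u v : ℂ)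
    (X : Fin M → ℂ) : Commute (opB s z (rootAngle M K) v) (limB s z M K u X) := by
  have hc : Tendsto (fun γ => opB s z γ v) (𝓝[≠] rootAngle M K)
      (𝓝 (opB s z (rootAngle M K) v)) :=
    ((smoothEntries_monodromy s z contDiff_id contDiff_const 0 1).continuous.tendsto _).mono_left
      nhdsWithin_le_nhds
  have h := tendsto_regB s z hz hM hK u X
  refine tendsto_nhds_unique (hc.mul h) ((h.mul hc).congr fun γ => ?_)
  have : Commute (opB s z γ v) (regB s z M K u X γ) := by
    refine Commute.smul_right (Commute.list_prod_right _ _ fun x hx => ?_) _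
    obtain ⟨r, rfl⟩ := List.mem_ofFn.1 hx
    exact commute_opB s z hz γ _ _
  exact this.symm.eq

theorem exchangeRel_opA (hz : ∀ i, z i ≠ 0) (γ : ℂ) :
    ExchangeRel (qval γ) (opA s z γ) (opB s z γ) :=
  (satisfiesRTT_monodromy s z γ hz).exchange_A_B

theorem exchangeRel_opD (hz : ∀ i, z i ≠ 0) (γ : ℂ) :
    ExchangeRel (qval γ)⁻¹ (opD s z γ) (opB s z γ) := by
  intro u v
  rw [inv_inv]
  exact (satisfiesRTT_monodromy s z γ hz).exchange_D_B u v

end Limit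

/-! ### Moving `A` or `D` past `𝔹(u; X)` -/

section CyclicShift

-- `U` is a string and `τ` the cyclic shift that multiplies its points by `e²`, `e = q₀` or `q₀⁻¹`
variable {M : ℕ} {e : ℂ} {U : Fin M → ℂ} {τ : Equiv.Perm (Fin M)}

theorem mul_inv_sub_mul (he : e ≠ 0) (hτ : ∀ r, U (τ r) = U r * e ^ 2) (x : ℂ) (a : Fin M) :
    x * e⁻¹ - U a * e = e⁻¹ * (x - U (τ a)) := by
  rw [hτ]
  field_simp

/-- The product of the wanted coefficients over a string telescopes. -/
theorem prod_wanted_string (he : e ≠ 0) (hτ : ∀ r, U (τ r) = U r * e ^ 2) {w : ℂ}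
    (hw : ∀ a, w ≠ U a) : ∏ a, wanted e w (U a) = e⁻¹ ^ M := by
  simp only [wanted, mul_inv_sub_mul he hτ]
  rw [Finset.prod_div_distrib, Finset.prod_mul_distrib, Finset.prod_const, Finset.card_univ,
    Fintype.card_fin, Equiv.prod_comp τ fun a => w - U a, mul_div_assoc, div_self, mul_one]
  exact Finset.prod_ne_zero_iff.2 fun a _ => sub_ne_zero.2 (hw a)

/-- The product of the wanted coefficients at a point of the string, without the factor that vanishes,
telescopes. -/
theorem prod_wanted_string_erase (he : e ≠ 0) (hτ : ∀ r, U (τ r) = U r * e ^ 2)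
    (hU : Function.Injective U) {r c : Fin M} (hc : τ c = r) (hcr : c ≠ r) :
    (∏ a ∈ (Finset.univ.erase r).erase c, wanted e (U r) (U a)) / (U r - U c) =
      e⁻¹ ^ (M - 2) / (U r - U (τ r)) := by
  have hne : ∀ a, a ≠ r → U r - U a ≠ 0 := fun a ha => sub_ne_zero.2 fun h => ha (hU h).symm
  have hτr : τ r ≠ r := fun h => hcr (τ.injective (hc.trans h.symm))
  have hcard : ((Finset.univ.erase r).erase c).card = M - 2 := by
    rw [Finset.card_erase_of_mem (by simp [hcr]), Finset.card_erase_of_mem (by simp),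
      Finset.card_univ, Fintype.card_fin]
    rfl
  have h1 : ∏ a ∈ (Finset.univ.erase r).erase c, (U r - U (τ a)) =
      ∏ b ∈ (Finset.univ.erase r).erase (τ r), (U r - U b) := by
    refine Finset.prod_equiv τ (fun a => ?_) fun a _ => rfl
    simp only [Finset.mem_erase, Finset.mem_univ, and_true, ne_eq, τ.injective.eq_iff]
    rw [← hc, τ.injective.eq_iff, and_comm]
  have h2 : ∏ a ∈ (Finset.univ.erase r).erase c, (U r - U a) ≠ 0 :=
    Finset.prod_ne_zero_iff.2 fun a ha =>
      hne a (Finset.ne_of_mem_erase (Finset.mem_of_mem_erase ha))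
  have h3 := Finset.mul_prod_erase (Finset.univ.erase r) (fun a => U r - U a)
    (a := c) (by simp [hcr])
  have h4 := Finset.mul_prod_erase (Finset.univ.erase r) (fun a => U r - U a)
    (a := τ r) (by simp [hτr])
  simp only [wanted, mul_inv_sub_mul he hτ]
  rw [Finset.prod_div_distrib, Finset.prod_mul_distrib, Finset.prod_const, hcard, h1]
  have h5 := hne c hcr
  have h6 := hne (τ r) hτr
  rw [div_div, div_eq_div_iff (mul_ne_zero h2 h5) h6]
  linear_combination e⁻¹ ^ (M - 2) * (h4 - h3)

end CyclicShift

section ExchangeLimit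

variable {N : ℕ} (s : Fin N → ℕ) (z : Fin N → ℂ) {M : ℕ} {K : ℤ}

/-- The argument `u q ^ (2r) η ^ (x_{r+1})` of the `r`-th factor of the string, at `q = e^{iγ}`. -/
noncomputable def stringPoint (M : ℕ) (K : ℤ) (u : ℂ) (X : Fin M → ℂ) (γ : ℂ) (r : Fin M) : ℂ :=
  u * qval γ ^ (2 * (r : ℕ)) * qpow (γ - rootAngle M K) (X r)

theorem stringPoint_rootAngle (u : ℂ) (X : Fin M → ℂ) (r : Fin M) :
    stringPoint M K u X (rootAngle M K) r = u * q0 M K ^ (2 * (r : ℕ)) := by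
  simp [stringPoint, qpow, q0]

theorem contDiff_stringPoint (u : ℂ) (X : Fin M → ℂ) (r : Fin M) :
    ContDiff ℂ 1 fun γ => stringPoint M K u X γ r :=
  (contDiff_const.mul ((contDiff_qpow contDiff_id contDiff_const).pow _)).mul
    (contDiff_qpow (contDiff_id.sub contDiff_const) contDiff_const)

theorem hasDerivAt_stringPoint (u : ℂ) (X : Fin M → ℂ) (r : Fin M) :
    HasDerivAt (fun γ => stringPoint M K u X γ r)
      (Complex.I * (2 * (r : ℕ) + X r) * (u * q0 M K ^ (2 * (r : ℕ)))) (rootAngle M K) := by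
  have e : (fun γ => stringPoint M K u X γ r) = fun γ =>
      u * qpow (-rootAngle M K) (X r) * qpow γ (2 * (r : ℕ) + X r) := by
    funext γ
    have h1 : qval γ ^ (2 * (r : ℕ)) = qpow γ (2 * (r : ℕ)) := by
      rw [← qpow_natCast]; push_cast; rfl
    have h2 : qpow (γ - rootAngle M K) (X r) = qpow γ (X r) * qpow (-rootAngle M K) (X r) := by
      simp only [qpow, ← Complex.exp_add]; ring_nf
    rw [stringPoint, h1, h2, qpow_add]
    ring
  have h := (hasDerivAt_qpow (rootAngle M K) (2 * (r : ℕ) + X r)).const_mul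
    (u * qpow (-rootAngle M K) (X r))
  rw [e]
  refine h.congr_deriv ?_
  rw [← stringPoint_rootAngle (K := K) u X r, congrFun e (rootAngle M K)]
  ring

/-- The product of wanted coefficients at the `r`-th point of a string vanishes at `γ₀` because of the
factor with index `τ⁻¹ r`; the limit is its derivative with respect to `q`. With `σ = 1` for `A` and
`σ = -1` for `D`, both operators are covered. -/
theorem tendsto_prod_wanted {u σ : ℂ} (X : Fin M → ℂ) {τ : Equiv.Perm (Fin M)}
    (hU : Function.Injective fun r : Fin M => u * q0 M K ^ (2 * (r : ℕ)))
    (hτ : ∀ r : Fin M, u * q0 M K ^ (2 * (τ r : ℕ)) =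
      u * q0 M K ^ (2 * (r : ℕ)) * qpow (rootAngle M K) σ ^ 2)
    (r : Fin M) (hr : τ.symm r ≠ r) :
    Tendsto (fun γ => (qval γ - q0 M K)⁻¹ * ∏ a ∈ Finset.univ.erase r,
        wanted (qpow γ σ) (stringPoint M K u X γ r) (stringPoint M K u X γ a))
      (𝓝[≠] rootAngle M K)
      (𝓝 ((q0 M K)⁻¹ * (u * q0 M K ^ (2 * (r : ℕ))) * (qpow (rootAngle M K) σ)⁻¹ *
        (2 * (r : ℕ) + X r - (2 * (τ.symm r : ℕ) + X (τ.symm r)) - 2 * σ) *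
        ((qpow (rootAngle M K) σ)⁻¹ ^ (M - 2) /
          (u * q0 M K ^ (2 * (r : ℕ)) - u * q0 M K ^ (2 * (τ r : ℕ)))))) := by
  set c := τ.symm r with hc
  have hτc : τ c = r := by simp [hc]
  set e := qpow (rootAngle M K) σ with he
  have he0 : e ≠ 0 := qpow_ne_zero _ _
  have hlim : ∀ a, Tendsto (fun γ => stringPoint M K u X γ a) (𝓝[≠] rootAngle M K)
      (𝓝 (u * q0 M K ^ (2 * (a : ℕ)))) := fun a => by
    have h := (contDiff_stringPoint (K := K) u X a).continuous.tendsto (rootAngle M K)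
    rw [stringPoint_rootAngle] at h
    exact h.mono_left nhdsWithin_le_nhds
  have hlimE : Tendsto (fun γ => qpow γ σ) (𝓝[≠] rootAngle M K) (𝓝 e) :=
    ((contDiff_qpow contDiff_id contDiff_const).continuous.tendsto _).mono_left
      nhdsWithin_le_nhds
  have hsub : ∀ a, a ≠ r →
      u * q0 M K ^ (2 * (r : ℕ)) - u * q0 M K ^ (2 * (a : ℕ)) ≠ 0 :=
    fun a ha => sub_ne_zero.2 fun h => ha (hU h).symm
  have hrc : u * q0 M K ^ (2 * (r : ℕ)) = u * q0 M K ^ (2 * (c : ℕ)) * e ^ 2 := by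
    rw [← hτ c, hτc]
  -- the vanishing numerator
  have hE1 : HasDerivAt (fun γ => qpow γ σ) (Complex.I * σ * e) (rootAngle M K) :=
    hasDerivAt_qpow _ _
  have hE2 : HasDerivAt (fun γ => (qpow γ σ)⁻¹) (-(Complex.I * σ * e⁻¹)) (rootAngle M K) := by
    refine (hE1.fun_inv he0).congr_deriv ?_
    rw [← he]
    field_simp
  have hf := ((hasDerivAt_stringPoint (K := K) u X r).mul hE2).sub
    ((hasDerivAt_stringPoint (K := K) u X c).mul hE1)
  have h1 := tendsto_inv_sub_mul hf (by
    simp only [Pi.sub_apply, Pi.mul_apply, stringPoint_rootAngle, hrc, ← he]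
    field_simp
    ring)
  have h2 : Tendsto (fun γ => (stringPoint M K u X γ r - stringPoint M K u X γ c)⁻¹)
      (𝓝[≠] rootAngle M K)
      (𝓝 (u * q0 M K ^ (2 * (r : ℕ)) - u * q0 M K ^ (2 * (c : ℕ)))⁻¹) :=
    ((hlim r).sub (hlim c)).inv₀ (hsub c hr)
  have h3 : Tendsto (fun γ => ∏ a ∈ (Finset.univ.erase r).erase c,
        wanted (qpow γ σ) (stringPoint M K u X γ r) (stringPoint M K u X γ a))
      (𝓝[≠] rootAngle M K) (𝓝 (∏ a ∈ (Finset.univ.erase r).erase c,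
        wanted e (u * q0 M K ^ (2 * (r : ℕ))) (u * q0 M K ^ (2 * (a : ℕ))))) := by
    refine tendsto_finsetProd _ fun a ha => ?_
    have har : a ≠ r := Finset.ne_of_mem_erase (Finset.mem_of_mem_erase ha)
    exact (((hlim r).mul (hlimE.inv₀ he0)).sub ((hlim a).mul hlimE)).div
      ((hlim r).sub (hlim a)) (hsub a har)
  have key := prod_wanted_string_erase (U := fun r : Fin M => u * q0 M K ^ (2 * (r : ℕ)))
    he0 hτ hU hτc hr
  rw [← key]
  convert (h1.mul h2).mul h3 using 1
  · funext γ
    rw [← Finset.mul_prod_erase (Finset.univ.erase r) _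
      (Finset.mem_erase.2 ⟨hr, Finset.mem_univ c⟩)]
    simp only [wanted, Pi.sub_apply, Pi.mul_apply]
    ring
  · congr 1
    rw [stringPoint_rootAngle, stringPoint_rootAngle, ← he, hrc]
    have := q0_ne_zero (M := M) (K := K)
    have hI := Complex.I_ne_zero
    field_simp
    ring

/-- The relation between `Y = A` (`σ = 1`) or `Y = D` (`σ = -1`) and `𝔹(u; X)`, obtained from
`ExchangeRel.mul_prod` by dividing by `q - q₀` and letting `q → q₀`. The combination
`2r + x_{r+1}` appears because `u q ^ (2r) η ^ x` has the logarithmic derivative `2r + x` with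
respect to `log q`. -/
theorem exchange_limB (hz : ∀ i, z i ≠ 0) (hM : 1 < M) (hK : IsCoprime K (M : ℤ)) {u σ : ℂ}
    (hu : u ≠ 0) (X : Fin M → ℂ) {τ : Equiv.Perm (Fin M)}
    (hτ : ∀ r : Fin M, u * q0 M K ^ (2 * (τ r : ℕ)) =
      u * q0 M K ^ (2 * (r : ℕ)) * qpow (rootAngle M K) σ ^ 2)
    (hτ' : ∀ r, τ r ≠ r)
    {Y : ℂ → ℂ → Op s} (hY : ∀ γ, ExchangeRel (qpow γ σ) (Y γ) (opB s z γ))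
    (hYc : Continuous fun p : ℂ × ℂ => Y p.1 p.2) {w : ℂ}
    (hw : ∀ r : Fin M, w ≠ u * q0 M K ^ (2 * (r : ℕ))) :
    Y (rootAngle M K) w * limB s z M K u X =
      (qpow (rootAngle M K) σ)⁻¹ ^ M • (limB s z M K u X * Y (rootAngle M K) w) -
      ∑ r : Fin M, (u * q0 M K ^ (2 * (r : ℕ)) / (w - u * q0 M K ^ (2 * (r : ℕ))) * (q0 M K)⁻¹ *
          (qpow (rootAngle M K) σ)⁻¹ ^ M *
          (2 * (r : ℕ) + X r - (2 * (τ.symm r : ℕ) + X (τ.symm r)) - 2 * σ)) •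
        (opB s z (rootAngle M K) w * (List.ofFn fun a : Fin M =>
          if a = r then 1 else opB s z (rootAngle M K) (u * q0 M K ^ (2 * (a : ℕ)))).prod *
          Y (rootAngle M K) (u * q0 M K ^ (2 * (r : ℕ)))) := by
  set e := qpow (rootAngle M K) σ with he
  have he0 : e ≠ 0 := qpow_ne_zero _ _
  have hU : Function.Injective fun r : Fin M => u * q0 M K ^ (2 * (r : ℕ)) := by
    intro a b hab
    have h := mul_left_cancel₀ hu hab
    rw [pow_mul, pow_mul] at h
    exact Fin.ext ((isPrimitiveRoot_q0_sq (by omega) hK).pow_inj a.2 b.2 h)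
  have hlim : ∀ a, Tendsto (fun γ => stringPoint M K u X γ a) (𝓝[≠] rootAngle M K)
      (𝓝 (u * q0 M K ^ (2 * (a : ℕ)))) := fun a => by
    have h := (contDiff_stringPoint (K := K) u X a).continuous.tendsto (rootAngle M K)
    rw [stringPoint_rootAngle] at h
    exact h.mono_left nhdsWithin_le_nhds
  have hlimE : Tendsto (fun γ => qpow γ σ) (𝓝[≠] rootAngle M K) (𝓝 e) :=
    ((contDiff_qpow contDiff_id contDiff_const).continuous.tendsto _).mono_left
      nhdsWithin_le_nhds
  have hlimY : ∀ {f : ℂ → ℂ} {c : ℂ}, Tendsto f (𝓝[≠] rootAngle M K) (𝓝 c) →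
      Tendsto (fun γ => Y γ (f γ)) (𝓝[≠] rootAngle M K) (𝓝 (Y (rootAngle M K) c)) :=
    fun hf => (hYc.tendsto _).comp
      ((tendsto_id.mono_left nhdsWithin_le_nhds).prodMk_nhds hf)
  have hlimB : Tendsto (fun γ => opB s z γ w) (𝓝[≠] rootAngle M K)
      (𝓝 (opB s z (rootAngle M K) w)) :=
    ((smoothEntries_monodromy s z contDiff_id contDiff_const 0 1).continuous.tendsto _).mono_left
      nhdsWithin_le_nhds
  have hlimP : ∀ r, Tendsto (fun γ => (List.ofFn fun a : Fin M =>
        if a = r then 1 else opB s z γ (stringPoint M K u X γ a)).prod) (𝓝[≠] rootAngle M K)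
      (𝓝 (List.ofFn fun a : Fin M => if a = r then 1 else
        opB s z (rootAngle M K) (u * q0 M K ^ (2 * (a : ℕ)))).prod) := by
    intro r
    have hsm : SmoothEntries fun γ => (List.ofFn fun a : Fin M =>
        if a = r then 1 else opB s z γ (stringPoint M K u X γ a)).prod := by
      refine SmoothEntries.prod_ofFn fun a => ?_
      by_cases har : a = r
      · simp only [har, if_true]
        exact fun _ _ => contDiff_const
      · simp only [har, if_false]
        exact smoothEntries_monodromy s z contDiff_id (contDiff_stringPoint u X a) 0 1
    have h := (hsm.continuous.tendsto (rootAngle M K)).mono_left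
      (nhdsWithin_le_nhds (s := {rootAngle M K}ᶜ))
    simpa only [stringPoint_rootAngle] using h
  have hreg := tendsto_regB s z hz hM hK u X
  have hsub : ∀ r : Fin M, w - u * q0 M K ^ (2 * (r : ℕ)) ≠ 0 := fun r => sub_ne_zero.2 (hw r)
  -- the exchange relation for `q ≠ q₀`, divided by `q - q₀`
  have hgen : ∀ᶠ γ in 𝓝[≠] rootAngle M K, Y γ w * regB s z M K u X γ =
      (∏ a, wanted (qpow γ σ) w (stringPoint M K u X γ a)) • (regB s z M K u X γ * Y γ w) +
      ∑ r, (unwanted (qpow γ σ) w (stringPoint M K u X γ r) * ((qval γ - q0 M K)⁻¹ *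
          ∏ a ∈ Finset.univ.erase r,
            wanted (qpow γ σ) (stringPoint M K u X γ r) (stringPoint M K u X γ a))) •
        (opB s z γ w * (List.ofFn fun a : Fin M =>
          if a = r then 1 else opB s z γ (stringPoint M K u X γ a)).prod *
          Y γ (stringPoint M K u X γ r)) := by
    have hinj : ∀ᶠ γ in 𝓝[≠] rootAngle M K, ∀ a b : Fin M, a ≠ b →
        stringPoint M K u X γ a ≠ stringPoint M K u X γ b := by
      refine eventually_all.2 fun a => eventually_all.2 fun b => ?_
      by_cases hab : a = b
      · simp [hab]
      · filter_upwards [((hlim a).sub (hlim b)).eventually_ne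
          (sub_ne_zero.2 fun h => hab (hU h))] with γ hγ _
        exact sub_ne_zero.1 hγ
    have hne : ∀ᶠ γ in 𝓝[≠] rootAngle M K, ∀ a : Fin M, w ≠ stringPoint M K u X γ a :=
      eventually_all.2 fun a => ((hlim a).eventually_ne (hw a).symm).mono fun γ h => h.symm
    filter_upwards [hinj, hne] with γ h1 h2
    have h := (hY γ).mul_prod (commute_opB s z hz γ)
      (v := stringPoint M K u X γ) (fun a b hab => by_contra fun hne => h1 a b hne hab) h2
    change Y γ w * ((qval γ - q0 M K)⁻¹ •
      (List.ofFn fun a => opB s z γ (stringPoint M K u X γ a)).prod) = _ • (((qval γ - q0 M K)⁻¹ •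
      (List.ofFn fun a => opB s z γ (stringPoint M K u X γ a)).prod) * _) + _
    rw [mul_smul_comm, h, smul_add, smul_comm, smul_mul_assoc, Finset.smul_sum]
    congr 1
    refine Finset.sum_congr rfl fun r _ => ?_
    rw [smul_smul]
    congr 1
    ring
  -- the two sides of `hgen` converge to the two sides of the claim
  refine tendsto_nhds_unique ((hlimY tendsto_const_nhds).mul hreg) ?_
  refine Tendsto.congr' (EventuallyEq.symm hgen) ?_
  rw [sub_eq_add_neg, ← Finset.sum_neg_distrib]
  refine Tendsto.add ?_ (tendsto_finsetSum _ fun r _ => ?_)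
  · refine Tendsto.smul ?_ (hreg.mul (hlimY tendsto_const_nhds))
    rw [← prod_wanted_string he0 hτ hw]
    exact tendsto_finsetProd _ fun a _ =>
      ((tendsto_const_nhds.mul (hlimE.inv₀ he0)).sub ((hlim a).mul hlimE)).div
        (tendsto_const_nhds.sub (hlim a)) (hsub a)
  · rw [← neg_smul]
    refine Tendsto.smul ?_ ((hlimB.mul (hlimP r)).mul (hlimY (hlim r)))
    have hr : τ.symm r ≠ r := fun h => hτ' r (by rw [Equiv.symm_apply_eq] at h; exact h.symm)
    have h1 : Tendsto (fun γ => unwanted (qpow γ σ) w (stringPoint M K u X γ r))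
        (𝓝[≠] rootAngle M K) (𝓝 (unwanted e w (u * q0 M K ^ (2 * (r : ℕ))))) :=
      ((hlim r).mul (hlimE.sub (hlimE.inv₀ he0))).div (tendsto_const_nhds.sub (hlim r)) (hsub r)
    convert h1.mul (tendsto_prod_wanted X hU hτ r hr) using 2
    have he2 : 1 - e ^ 2 ≠ 0 := by
      intro h
      refine hτ' r (hU ?_)
      simp only [hτ r]
      rw [show e ^ 2 = 1 by linear_combination -h, mul_one]
    have hpow : e⁻¹ ^ M = e⁻¹ ^ (M - 2) * (e⁻¹ * e⁻¹) := by
      rw [← pow_two, ← pow_add, Nat.sub_add_cancel hM]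
    rw [hτ r, ← he, hpow, unwanted]
    have hq := pow_ne_zero (2 * (r : ℕ)) (q0_ne_zero (M := M) (K := K))
    have hs := hsub r
    have hd : u * q0 M K ^ (2 * (r : ℕ)) - u * q0 M K ^ (2 * (r : ℕ)) * e ^ 2 =
      u * q0 M K ^ (2 * (r : ℕ)) * (1 - e ^ 2) := by ring
    rw [hd]
    generalize q0 M K ^ (2 * (r : ℕ)) = ζ at *
    generalize e⁻¹ ^ (M - 2) = E
    field_simp
    ring

end ExchangeLimit

/-! ### The functions `Q`, `F`, `G` -/

section Functions

variable {N : ℕ} (s : Fin N → ℕ) (z : Fin N → ℂ) {M : ℕ} {K : ℤ} {k : ℕ} (t : Fin k → ℂ) (p : ℤ)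

theorem q0_pow_two_mul (hM : 1 < M) (hK : IsCoprime K (M : ℤ)) : q0 M K ^ (2 * M) = 1 := by
  rw [pow_mul, (isPrimitiveRoot_q0_sq (by omega) hK).pow_eq_one]

theorem inv_q0_pow (hM : 1 < M) (hK : IsCoprime K (M : ℤ)) : (q0 M K)⁻¹ ^ M = q0 M K ^ M := by
  rw [inv_pow]
  refine inv_eq_of_mul_eq_one_right ?_
  rw [← pow_add, ← two_mul, q0_pow_two_mul hM hK]

theorem mul_q0_pow_pow (hM : 1 < M) (hK : IsCoprime K (M : ℤ)) (u : ℂ) (r : ℕ) :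
    (u * q0 M K ^ (2 * r)) ^ M = u ^ M := by
  rw [mul_pow, ← pow_mul, mul_right_comm, pow_mul, q0_pow_two_mul hM hK, one_pow, mul_one]

/-- The zeros of `P` form strings, so `P` solves the difference equation that relates the vacuum
eigenvalues of `A` and `D`. -/
theorem polyP_mul_vacA (v : ℂ) :
    polyP s z M K v * vacA s z (rootAngle M K) v =
      q0 M K ^ (-∑ i, (s i : ℤ)) * polyP s z M K (v * q0 M K ^ 2) *
        vacD s z (rootAngle M K) v := by
  have hq := q0_ne_zero (M := M) (K := K)
  have hpow : q0 M K ^ (-∑ i, (s i : ℤ)) = ∏ i, (q0 M K ^ (s i))⁻¹ := by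
    rw [_root_.zpow_neg, ← Nat.cast_sum, zpow_natCast, ← Finset.prod_pow_eq_pow_sum,
      Finset.prod_inv_distrib]
  rw [hpow, polyP, polyP, vacA, vacD, ← Finset.prod_mul_distrib, ← Finset.prod_mul_distrib,
    ← Finset.prod_mul_distrib]
  refine Finset.prod_congr rfl fun i _ => ?_
  set n := s i
  set f : ℕ → ℂ := fun r => v - z i * q0 M K ^ ((n : ℤ) - 2 * (r : ℤ)) with hf
  set h := qpow (rootAngle M K) ((n : ℂ) / 2) with hh
  have hh0 : h ≠ 0 := qpow_ne_zero _ _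
  have hsq : q0 M K ^ n = h ^ 2 := by
    rw [pow_two, hh, ← qpow_add, add_halves, qpow_natCast, q0]
  have hA : v * h - z i * h⁻¹ = h * f n := by
    have e : q0 M K ^ ((n : ℤ) - 2 * (n : ℤ)) = (h ^ 2)⁻¹ := by
      rw [show (n : ℤ) - 2 * n = -n by ring, _root_.zpow_neg, zpow_natCast, hsq]
    simp only [hf, e]
    field_simp
  have hD : v * h⁻¹ - z i * h = h⁻¹ * f 0 := by
    have e : q0 M K ^ ((n : ℤ) - 2 * ((0 : ℕ) : ℤ)) = h ^ 2 := by
      rw [Nat.cast_zero, mul_zero, sub_zero, zpow_natCast, hsq]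
    simp only [hf, e]
    field_simp
  have hP : ∏ r ∈ Finset.range n, (v * q0 M K ^ 2 - z i * q0 M K ^ ((n : ℤ) - 2 * (r : ℤ))) =
      (h ^ 2) ^ 2 * ∏ r ∈ Finset.range n, f (r + 1) := by
    rw [← hsq, ← pow_mul, mul_comm n, pow_mul]
    conv_rhs => rw [← Finset.card_range n, ← Finset.prod_const, Finset.card_range]
    rw [← Finset.prod_mul_distrib]
    refine Finset.prod_congr rfl fun r _ => ?_
    have e : q0 M K ^ ((n : ℤ) - 2 * (r : ℤ)) =
        q0 M K ^ 2 * q0 M K ^ ((n : ℤ) - 2 * ((r + 1 : ℕ) : ℤ)) := by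
      rw [← zpow_natCast (q0 M K) 2, ← zpow_add₀ hq]
      congr 1
      push_cast
      ring
    simp only [hf]
    rw [e]
    ring
  have htel := (Finset.prod_range_succ f n).symm.trans (Finset.prod_range_succ' f n)
  rw [qpow_neg, ← hh, hP, hA, hD, hsq]
  have : (h ^ 2)⁻¹ * ((h ^ 2) ^ 2 * ∏ r ∈ Finset.range n, f (r + 1)) * (h⁻¹ * f 0) =
      h * ((∏ r ∈ Finset.range n, f (r + 1)) * f 0) := by
    field_simp
  rw [this, ← htel]
  ring

theorem funF_mul_q0_sq (hM : 1 < M) (hK : IsCoprime K (M : ℤ)) (u : ℂ) :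
    funF s z M K t p (u * q0 M K ^ 2) = funF s z M K t p u := by
  rw [funF, funF]
  congr 1
  have h := Finset.sum_range_sub (fun r => funQ s z M K t p (u * q0 M K ^ (2 * r))) M
  rw [Finset.sum_sub_distrib, q0_pow_two_mul hM hK, mul_zero, pow_zero, sub_self,
    sub_eq_zero] at h
  rw [← h]
  refine Finset.sum_congr rfl fun r _ => ?_
  congr 1
  ring

theorem funF_mul_q0_pow (hM : 1 < M) (hK : IsCoprime K (M : ℤ)) (u : ℂ) (r : ℕ) :
    funF s z M K t p (u * q0 M K ^ (2 * r)) = funF s z M K t p u := by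
  induction r with
  | zero => simp
  | succ r ih =>
    rw [← ih, ← funF_mul_q0_sq s z t p hM hK (u * q0 M K ^ (2 * r))]
    congr 1
    ring

/-- The difference equation solved by `G`. -/
theorem funG_mul_q0_sq (hM : 1 < M) (hK : IsCoprime K (M : ℤ)) (u : ℂ) :
    funG s z M K t p (u * q0 M K ^ 2) =
      funG s z M K t p u + funQ s z M K t p u - funF s z M K t p u := by
  have hM0 : (M : ℂ) ≠ 0 := by
    have : M ≠ 0 := by omega
    exact_mod_cast this
  have hG : ∀ x, funG s z M K t p x =
      1 / (M : ℂ) * ∑ r ∈ Finset.range M, (r : ℂ) * funQ s z M K t p (x * q0 M K ^ (2 * r)) := by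
    intro x
    rw [funG]
    congr 1
    refine Finset.sum_subset (fun r hr => ?_) fun r hr hr' => ?_
    · rw [Finset.mem_Icc] at hr
      rw [Finset.mem_range]
      omega
    · rw [Finset.mem_range] at hr
      rw [Finset.mem_Icc] at hr'
      have : r = 0 := by omega
      simp [this]
  have h1 := Finset.sum_range_sub
    (fun r : ℕ => (r : ℂ) * funQ s z M K t p (u * q0 M K ^ (2 * r))) M
  have h2 := funF_mul_q0_sq s z t p hM hK u
  have hF : ∑ r ∈ Finset.range M, funQ s z M K t p (u * q0 M K ^ (2 * (r + 1))) =
      M * funF s z M K t p u := by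
    rw [← h2, funF, ← mul_assoc, mul_one_div_cancel hM0, one_mul]
    refine Finset.sum_congr rfl fun r _ => ?_
    congr 1
    ring
  have hG' : ∑ r ∈ Finset.range M, (r : ℂ) * funQ s z M K t p (u * q0 M K ^ (2 * (r + 1))) =
      M * funG s z M K t p (u * q0 M K ^ 2) := by
    rw [hG, ← mul_assoc, mul_one_div_cancel hM0, one_mul]
    refine Finset.sum_congr rfl fun r _ => ?_
    congr 2
    ring
  have hG'' : ∑ r ∈ Finset.range M, (r : ℂ) * funQ s z M K t p (u * q0 M K ^ (2 * r)) =
      M * funG s z M K t p u := by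
    rw [hG, ← mul_assoc, mul_one_div_cancel hM0, one_mul]
  simp only [Nat.cast_add, Nat.cast_one, add_mul, one_mul, Finset.sum_sub_distrib,
    Finset.sum_add_distrib, hF, hG', hG'', q0_pow_two_mul hM hK, mul_one, Nat.cast_zero, zero_mul,
    sub_zero] at h1
  refine mul_left_cancel₀ hM0 ?_
  linear_combination h1

/-- The right-hand side depends on the point `u q₀ ^ (2r)` only, so it is periodic in `r`, and the
boundary of the string needs no separate treatment. -/
theorem two_mul_add_xVec {u : ℂ} (r : Fin M) :
    2 * ((r : ℕ) : ℂ) + xVec s z M K t p u r =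
      -2 * funG s z M K t p (u * q0 M K ^ (2 * (r : ℕ)) * q0 M K ^ 2) / funF s z M K t p u := by
  rw [xVec, xCoord, mul_assoc u, ← pow_add, ← mul_add_one]
  push_cast
  ring

/-- The value of the exchange coefficient for `A`. -/
theorem xVec_sub_prev (hM : 1 < M) (hK : IsCoprime K (M : ℤ)) {u : ℂ}
    (hF : funF s z M K t p u ≠ 0) {r c : Fin M}
    (h : u * q0 M K ^ (2 * (r : ℕ)) = u * q0 M K ^ (2 * (c : ℕ)) * q0 M K ^ 2) :
    2 * ((r : ℕ) : ℂ) + xVec s z M K t p u r - (2 * ((c : ℕ) : ℂ) + xVec s z M K t p u c) - 2 * 1 =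
      -2 * funQ s z M K t p (u * q0 M K ^ (2 * (r : ℕ))) / funF s z M K t p u := by
  rw [two_mul_add_xVec, two_mul_add_xVec, ← h, funG_mul_q0_sq s z t p hM hK,
    funF_mul_q0_pow s z t p hM hK]
  field_simp
  ring

/-- The value of the exchange coefficient for `D`. -/
theorem xVec_sub_next (hM : 1 < M) (hK : IsCoprime K (M : ℤ)) {u : ℂ}
    (hF : funF s z M K t p u ≠ 0) {r c : Fin M}
    (h : u * q0 M K ^ (2 * (c : ℕ)) = u * q0 M K ^ (2 * (r : ℕ)) * q0 M K ^ 2) :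
    2 * ((r : ℕ) : ℂ) + xVec s z M K t p u r - (2 * ((c : ℕ) : ℂ) + xVec s z M K t p u c) -
        2 * (-1) =
      2 * funQ s z M K t p (u * q0 M K ^ (2 * (r : ℕ)) * q0 M K ^ 2) / funF s z M K t p u := by
  rw [two_mul_add_xVec, two_mul_add_xVec, ← h, funG_mul_q0_sq s z t p hM hK _,
    funF_mul_q0_pow s z t p hM hK]
  field_simp
  ring

/-- The identity behind the choice of `Q`: the two unwanted terms in `T(w) 𝔹(u; X)` cancel. -/
theorem funQ_mul_vacA {κ : ℂ} (hκ : κ = q0 M K ^ (2 * p - ∑ i, (s i : ℤ))) {v : ℂ}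
    (ht : ∀ a, v ≠ t a) (ht' : ∀ a, v ≠ t a * q0 M K ^ 2)
    (ht'' : ∀ a, v * q0 M K ^ 2 ≠ t a) :
    funQ s z M K t p v * (vacA s z (rootAngle M K) v * ∏ a, wanted (q0 M K) v (t a)) =
      κ * funQ s z M K t p (v * q0 M K ^ 2) *
        (vacD s z (rootAngle M K) v * ∏ a, wanted (q0 M K)⁻¹ v (t a)) := by
  have hq := q0_ne_zero (M := M) (K := K)
  have h1 : ∏ a, (v - t a) ≠ 0 := Finset.prod_ne_zero_iff.2 fun a _ => sub_ne_zero.2 (ht a)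
  have h2 : ∏ a, (v - t a * q0 M K ^ 2) ≠ 0 :=
    Finset.prod_ne_zero_iff.2 fun a _ => sub_ne_zero.2 (ht' a)
  have w1 : ∏ a, wanted (q0 M K) v (t a) =
      (q0 M K)⁻¹ ^ k * (∏ a, (v - t a * q0 M K ^ 2)) / ∏ a, (v - t a) := by
    have : ∀ a, wanted (q0 M K) v (t a) =
        (q0 M K)⁻¹ * (v - t a * q0 M K ^ 2) / (v - t a) := fun a => by
      rw [wanted]; field_simp
    simp only [this, Finset.prod_div_distrib, Finset.prod_mul_distrib, Finset.prod_const,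
      Finset.card_univ, Fintype.card_fin]
  have w2 : ∏ a, wanted (q0 M K)⁻¹ v (t a) =
      (q0 M K)⁻¹ ^ k * (∏ a, (v * q0 M K ^ 2 - t a)) / ∏ a, (v - t a) := by
    have : ∀ a, wanted (q0 M K)⁻¹ v (t a) =
        (q0 M K)⁻¹ * (v * q0 M K ^ 2 - t a) / (v - t a) := fun a => by
      rw [wanted, inv_inv]; field_simp
    simp only [this, Finset.prod_div_distrib, Finset.prod_mul_distrib, Finset.prod_const,
      Finset.card_univ, Fintype.card_fin]
  have d2 : ∏ a, ((v * q0 M K ^ 2 - t a) * (v * q0 M K ^ 2 - t a * q0 M K ^ 2)) =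
      (∏ a, (v * q0 M K ^ 2 - t a)) * ((q0 M K ^ 2) ^ k * ∏ a, (v - t a)) := by
    have : ∀ a, v * q0 M K ^ 2 - t a * q0 M K ^ 2 = q0 M K ^ 2 * (v - t a) := fun a => by ring
    simp only [this, Finset.prod_mul_distrib, Finset.prod_const, Finset.card_univ,
      Fintype.card_fin]
  have h3 : ∏ a, (v * q0 M K ^ 2 - t a) ≠ 0 :=
    Finset.prod_ne_zero_iff.2 fun a _ => sub_ne_zero.2 (ht'' a)
  have hT : q0 M K ^ (2 * p) ≠ 0 := zpow_ne_zero _ hq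
  have e1 : κ = q0 M K ^ (2 * p) * q0 M K ^ (-∑ i, (s i : ℤ)) := by
    rw [hκ, sub_eq_add_neg, zpow_add₀ hq]
  have e2 : (v * q0 M K ^ 2) ^ ((k : ℤ) - p) =
      v ^ ((k : ℤ) - p) * ((q0 M K ^ 2) ^ k * (q0 M K ^ (2 * p))⁻¹) := by
    rw [mul_zpow, zpow_sub₀ (pow_ne_zero 2 hq), zpow_natCast, div_eq_mul_inv,
      ← zpow_natCast (q0 M K) 2, ← _root_.zpow_mul (q0 M K) _ p]
    rfl
  have hPA := polyP_mul_vacA (M := M) (K := K) s z v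
  rw [funQ, funQ, w1, w2, d2, e1, e2, Finset.prod_mul_distrib]
  have hk : (q0 M K ^ 2) ^ k ≠ 0 := pow_ne_zero _ (pow_ne_zero _ hq)
  generalize (q0 M K ^ 2) ^ k = Z at *
  generalize (q0 M K)⁻¹ ^ k = x at *
  generalize ∏ a, (v - t a) = a at *
  generalize ∏ a, (v - t a * q0 M K ^ 2) = b at *
  generalize ∏ a, (v * q0 M K ^ 2 - t a) = c at *
  generalize q0 M K ^ (2 * p) = T at *
  field_simp
  linear_combination v ^ ((k : ℤ) - p) * x * hPA

end Functions

/-! ### Bethe vectors -/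

section BetheVector

variable {N : ℕ} (s : Fin N → ℕ) (z : Fin N → ℂ) {M : ℕ} {K : ℤ} {k : ℕ} (t : Fin k → ℂ)

/-- The action on a Bethe vector of an operator family `Y = A`, `D` for which the vacuum is an
eigenvector, for arbitrary pairwise distinct `t_a`. -/
theorem mulVec_betheVector (hz : ∀ i, z i ≠ 0) {γ e : ℂ} {Y : ℂ → Op s}
    (hY : ExchangeRel e Y (opB s z γ)) {y : ℂ → ℂ}
    (hvac : ∀ v, (Y v).mulVec (vacuum s) = y v • vacuum s) (ht : IsOffdiagonal t) {w : ℂ}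
    (hw : ∀ a, w ≠ t a) :
    (Y w).mulVec (betheVector s z γ t) =
      (y w * ∏ a, wanted e w (t a)) • betheVector s z γ t +
      ∑ r, (unwanted e w (t r) * (∏ a ∈ Finset.univ.erase r, wanted e (t r) (t a)) * y (t r)) •
        (opB s z γ w).mulVec ((List.ofFn fun a => if a = r then 1 else opB s z γ (t a)).prod.mulVec
          (vacuum s)) := by
  have hinj : Function.Injective t := fun a b hab => by_contra fun hne => ht a b hne hab
  rw [betheVector, Matrix.mulVec_mulVec, hY.mul_prod (commute_opB s z hz γ) hinj hw,
    Matrix.add_mulVec, Matrix.smul_mulVec, ← Matrix.mulVec_mulVec, hvac, Matrix.mulVec_smul,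
    smul_smul, mul_comm (y w), Matrix.sum_mulVec]
  congr 1
  refine Finset.sum_congr rfl fun r _ => ?_
  rw [Matrix.smul_mulVec, ← Matrix.mulVec_mulVec, hvac, Matrix.mulVec_smul, smul_smul,
    Matrix.mulVec_mulVec]

theorem betheEigenvalue_eq (κ γ w : ℂ) :
    betheEigenvalue s z κ γ t w = vacA s z γ w * ∏ a, wanted (qval γ) w (t a) +
      κ * (vacD s z γ w * ∏ a, wanted (qval γ)⁻¹ w (t a)) := by
  simp only [betheEigenvalue, wanted, inv_inv, mul_assoc]

theorem transferMatrix_mulVec (κ γ w : ℂ) (ψ : Conf s → ℂ) :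
    (transferMatrix s z κ γ w).mulVec ψ =
      (opA s z γ w).mulVec ψ + κ • (opD s z γ w).mulVec ψ := by
  rw [transferMatrix, Matrix.add_mulVec, Matrix.smul_mulVec]

/-- For a solution of the Bethe equations the unwanted terms of `A` and `κ D` cancel. -/
theorem transferMatrix_mulVec_betheVector (hz : ∀ i, z i ≠ 0) {κ γ : ℂ}
    (hBethe : IsBetheSolution s z κ γ t) (ht : IsOffdiagonal t) {w : ℂ} (hw : ∀ a, w ≠ t a) :
    (transferMatrix s z κ γ w).mulVec (betheVector s z γ t) =
      betheEigenvalue s z κ γ t w • betheVector s z γ t := by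
  have hq := qval_ne_zero γ
  rw [transferMatrix_mulVec, mulVec_betheVector s z t hz (exchangeRel_opA s z hz γ)
      (opA_mulVec_vacuum s z γ hz) ht hw, mulVec_betheVector s z t hz (exchangeRel_opD s z hz γ)
      (opD_mulVec_vacuum s z γ hz) ht hw, betheEigenvalue_eq, add_smul, smul_add, smul_smul,
    add_add_add_comm]
  refine add_eq_left.2 ?_
  rw [Finset.smul_sum, ← Finset.sum_add_distrib]
  refine Finset.sum_eq_zero fun r _ => ?_
  rw [smul_smul, ← add_smul]
  refine smul_eq_zero_of_left ?_ _
  have w1 : ∏ a ∈ Finset.univ.erase r, wanted (qval γ) (t r) (t a) =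
      (qval γ)⁻¹ ^ (k - 1) * (∏ a ∈ Finset.univ.erase r, (t r - t a * qval γ ^ 2)) /
        ∏ a ∈ Finset.univ.erase r, (t r - t a) := by
    have : ∀ a, wanted (qval γ) (t r) (t a) =
        (qval γ)⁻¹ * (t r - t a * qval γ ^ 2) / (t r - t a) := fun a => by
      rw [wanted]; field_simp
    simp [this, Finset.prod_div_distrib, Finset.prod_mul_distrib]
  have w2 : ∏ a ∈ Finset.univ.erase r, wanted (qval γ)⁻¹ (t r) (t a) =
      (qval γ)⁻¹ ^ (k - 1) * (∏ a ∈ Finset.univ.erase r, (t r * qval γ ^ 2 - t a)) /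
        ∏ a ∈ Finset.univ.erase r, (t r - t a) := by
    have : ∀ a, wanted (qval γ)⁻¹ (t r) (t a) =
        (qval γ)⁻¹ * (t r * qval γ ^ 2 - t a) / (t r - t a) := fun a => by
      rw [wanted, inv_inv]; field_simp
    simp [this, Finset.prod_div_distrib, Finset.prod_mul_distrib]
  have hb := hBethe r
  rw [w1, w2]
  simp only [unwanted, inv_inv]
  linear_combination (t r * (qval γ - (qval γ)⁻¹) / (w - t r) * (qval γ)⁻¹ ^ (k - 1) /
    ∏ a ∈ Finset.univ.erase r, (t r - t a)) * hb

end BetheVector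

/-! ### Adding strings to a Bethe vector -/

section ExtBetheVector

variable {N : ℕ} (s : Fin N → ℕ) (z : Fin N → ℂ) {M : ℕ} {K : ℤ} {k : ℕ} (t : Fin k → ℂ) (p : ℤ)

theorem extBetheVector_zero (u : Fin 0 → ℂ) :
    extBetheVector s z M K t p u = betheVector s z (rootAngle M K) t := by
  simp [extBetheVector]

theorem extBetheVector_succ {m : ℕ} (u : Fin (m + 1) → ℂ) :
    extBetheVector s z M K t p u = (limB s z M K (u 0) (xVec s z M K t p (u 0))).mulVec
      (extBetheVector s z M K t p fun i => u i.succ) := by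
  rw [extBetheVector, extBetheVector, List.ofFn_succ, List.prod_cons, Matrix.mulVec_mulVec]

/-- `finRotate M` is the cyclic shift of a string by `q₀²`. -/
theorem q0_pow_finRotate (hM : 1 < M) (hK : IsCoprime K (M : ℤ)) (r : Fin M) :
    q0 M K ^ (2 * (finRotate M r : ℕ)) = q0 M K ^ (2 * (r : ℕ)) * q0 M K ^ 2 := by
  obtain ⟨n, rfl⟩ := Nat.exists_eq_succ_of_ne_zero (show M ≠ 0 by omega)
  rw [← pow_add, ← mul_add_one]
  by_cases hr : r = Fin.last n
  · subst hr
    rw [finRotate_last, Fin.val_last, Fin.val_zero, mul_zero, pow_zero]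
    exact (q0_pow_two_mul hM hK).symm
  · rw [coe_finRotate_of_ne_last hr]

theorem finRotate_ne_self (hM : 1 < M) (r : Fin M) : finRotate M r ≠ r := by
  obtain ⟨n, rfl⟩ := Nat.exists_eq_succ_of_ne_zero (show M ≠ 0 by omega)
  by_cases hr : r = Fin.last n
  · subst hr
    rw [finRotate_last]
    intro h
    have := congrArg Fin.val h
    simp at this
    omega
  · intro h
    have := congrArg Fin.val h
    rw [coe_finRotate_of_ne_last hr] at this
    omega

theorem exchange_opA_limB (hz : ∀ i, z i ≠ 0) (hM : 1 < M) (hK : IsCoprime K (M : ℤ)) {u : ℂ}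
    (hu : u ≠ 0) (hF : funF s z M K t p u ≠ 0) {w : ℂ}
    (hw : ∀ r : Fin M, w ≠ u * q0 M K ^ (2 * (r : ℕ))) :
    opA s z (rootAngle M K) w * limB s z M K u (xVec s z M K t p u) =
      q0 M K ^ M • (limB s z M K u (xVec s z M K t p u) * opA s z (rootAngle M K) w) +
      ∑ r : Fin M, (2 * q0 M K ^ M * (q0 M K)⁻¹ / funF s z M K t p u *
          (u * q0 M K ^ (2 * (r : ℕ)) / (w - u * q0 M K ^ (2 * (r : ℕ)))) *
          funQ s z M K t p (u * q0 M K ^ (2 * (r : ℕ)))) •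
        (opB s z (rootAngle M K) w * (List.ofFn fun a : Fin M =>
          if a = r then 1 else opB s z (rootAngle M K) (u * q0 M K ^ (2 * (a : ℕ)))).prod *
          opA s z (rootAngle M K) (u * q0 M K ^ (2 * (r : ℕ)))) := by
  have hτ : ∀ r : Fin M, u * q0 M K ^ (2 * (finRotate M r : ℕ)) =
      u * q0 M K ^ (2 * (r : ℕ)) * q0 M K ^ 2 := fun r => by
    rw [q0_pow_finRotate hM hK, mul_assoc]
  have h := exchange_limB (σ := 1) s z hz hM hK hu (xVec s z M K t p u) hτ
    (finRotate_ne_self hM) (exchangeRel_opA s z hz)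
    (smoothEntries_monodromy s z contDiff_fst contDiff_snd 0 0).continuous hw
  rw [h, show qpow (rootAngle M K) 1 = q0 M K from rfl, inv_q0_pow hM hK, sub_eq_add_neg,
    ← Finset.sum_neg_distrib]
  congr 1
  refine Finset.sum_congr rfl fun r _ => ?_
  have hc : u * q0 M K ^ (2 * (r : ℕ)) =
      u * q0 M K ^ (2 * ((finRotate M).symm r : ℕ)) * q0 M K ^ 2 := by
    rw [← hτ, Equiv.apply_symm_apply]
  rw [← neg_smul, xVec_sub_prev s z t p hM hK hF hc]
  congr 1
  ring

theorem exchange_opD_limB (hz : ∀ i, z i ≠ 0) (hM : 1 < M) (hK : IsCoprime K (M : ℤ)) {u : ℂ}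
    (hu : u ≠ 0) (hF : funF s z M K t p u ≠ 0) {w : ℂ}
    (hw : ∀ r : Fin M, w ≠ u * q0 M K ^ (2 * (r : ℕ))) :
    opD s z (rootAngle M K) w * limB s z M K u (xVec s z M K t p u) =
      q0 M K ^ M • (limB s z M K u (xVec s z M K t p u) * opD s z (rootAngle M K) w) -
      ∑ r : Fin M, (2 * q0 M K ^ M * (q0 M K)⁻¹ / funF s z M K t p u *
          (u * q0 M K ^ (2 * (r : ℕ)) / (w - u * q0 M K ^ (2 * (r : ℕ)))) *
          funQ s z M K t p (u * q0 M K ^ (2 * (r : ℕ)) * q0 M K ^ 2)) •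
        (opB s z (rootAngle M K) w * (List.ofFn fun a : Fin M =>
          if a = r then 1 else opB s z (rootAngle M K) (u * q0 M K ^ (2 * (a : ℕ)))).prod *
          opD s z (rootAngle M K) (u * q0 M K ^ (2 * (r : ℕ)))) := by
  have hq := q0_ne_zero (M := M) (K := K)
  have hτ : ∀ r : Fin M, u * q0 M K ^ (2 * (finRotate M r : ℕ)) =
      u * q0 M K ^ (2 * (r : ℕ)) * q0 M K ^ 2 := fun r => by
    rw [q0_pow_finRotate hM hK, mul_assoc]
  have hinv : ∀ γ, qpow γ (-1) = (qval γ)⁻¹ := fun γ => qpow_neg γ 1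
  have hinv0 : qpow (rootAngle M K) (-1) = (q0 M K)⁻¹ := hinv _
  have hτ' : ∀ r : Fin M, u * q0 M K ^ (2 * ((finRotate M).symm r : ℕ)) =
      u * q0 M K ^ (2 * (r : ℕ)) * qpow (rootAngle M K) (-1) ^ 2 := fun r => by
    have h := hτ ((finRotate M).symm r)
    rw [Equiv.apply_symm_apply] at h
    rw [h, hinv0]
    field_simp
  have h := exchange_limB (σ := -1) s z hz hM hK hu (xVec s z M K t p u) hτ'
    (fun r h => finRotate_ne_self hM r (by rw [Equiv.symm_apply_eq] at h; exact h.symm))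
    (fun γ => by rw [hinv]; exact exchangeRel_opD s z hz γ)
    (smoothEntries_monodromy s z contDiff_fst contDiff_snd 1 1).continuous hw
  rw [h, hinv0, inv_inv]
  congr 1
  refine Finset.sum_congr rfl fun r _ => ?_
  rw [Equiv.symm_symm, xVec_sub_next s z t p hM hK hF (hτ r)]
  congr 1
  ring

/-- `𝔹(u; X)` maps vectors on which `Y(v)` acts by a scalar up to the image of `B(v)` to vectors
with the same property. -/
theorem mulVec_limB_mulVec (hz : ∀ i, z i ≠ 0) (hM : 1 < M) (hK : IsCoprime K (M : ℤ)) {u : ℂ}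
    {X : Fin M → ℂ} {Y : ℂ → Op s} {v c : ℂ} {d : Fin M → ℂ} {E : Fin M → Op s} {Z : Fin M → Op s}
    (hY : Y v * limB s z M K u X = c • (limB s z M K u X * Y v) +
      ∑ r : Fin M, d r • (opB s z (rootAngle M K) v * E r * Z r))
    {ψ φ : Conf s → ℂ} {α : ℂ} (hψ : (Y v).mulVec ψ = α • ψ + (opB s z (rootAngle M K) v).mulVec φ) :
    ∃ φ', (Y v).mulVec ((limB s z M K u X).mulVec ψ) = (c * α) • (limB s z M K u X).mulVec ψ +
      (opB s z (rootAngle M K) v).mulVec φ' := by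
  refine ⟨c • (limB s z M K u X).mulVec φ + ∑ r, d r • (E r * Z r).mulVec ψ, ?_⟩
  rw [Matrix.mulVec_mulVec, hY, Matrix.add_mulVec, Matrix.smul_mulVec, ← Matrix.mulVec_mulVec, hψ,
    Matrix.mulVec_add, Matrix.mulVec_smul, smul_add, smul_smul, Matrix.mulVec_mulVec,
    ← (commute_opB_limB s z hz hM hK u v X).eq, Matrix.mulVec_add, Matrix.mulVec_smul,
    Matrix.mulVec_mulVec, add_assoc, Matrix.sum_mulVec, Matrix.mulVec_sum]
  congr 2
  refine Finset.sum_congr rfl fun r _ => ?_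
  rw [Matrix.smul_mulVec, Matrix.mulVec_smul, Matrix.mulVec_mulVec, mul_assoc]

/-- If `Y(v)` acts on `ψ` by a scalar up to the image of `B(v)`, then the correction is annihilated
by the product of the other operators `B` of the string through `v`. -/
theorem prod_ite_mul_mulVec (hz : ∀ i, z i ≠ 0) (hM : 1 < M) (hK : IsCoprime K (M : ℤ)) (u : ℂ)
    (r : Fin M) {Y : Op s} {ψ φ : Conf s → ℂ} {α : ℂ} (hψ : Y.mulVec ψ = α • ψ +
      (opB s z (rootAngle M K) (u * q0 M K ^ (2 * (r : ℕ)))).mulVec φ) :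
    ((List.ofFn fun a : Fin M => if a = r then 1 else
        opB s z (rootAngle M K) (u * q0 M K ^ (2 * (a : ℕ)))).prod * Y).mulVec ψ =
      α • (List.ofFn fun a : Fin M => if a = r then 1 else
        opB s z (rootAngle M K) (u * q0 M K ^ (2 * (a : ℕ)))).prod.mulVec ψ := by
  have h := prod_ofFn_ite_mul (commute_opB s z hz (rootAngle M K))
    (fun a : Fin M => u * q0 M K ^ (2 * (a : ℕ))) r
  rw [prod_opB_string_eq_zero s z hz hM hK] at h
  rw [← Matrix.mulVec_mulVec, hψ, Matrix.mulVec_add, Matrix.mulVec_smul, Matrix.mulVec_mulVec, h,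
    Matrix.zero_mulVec, add_zero]

end ExtBetheVector

section Induction

variable {N : ℕ} (s : Fin N → ℕ) (z : Fin N → ℂ) {M : ℕ} {K : ℤ} {k : ℕ} (t : Fin k → ℂ) (p : ℤ)

theorem ne_string_of_pow_ne (hM : 1 < M) (hK : IsCoprime K (M : ℤ)) {v u : ℂ}
    (h : v ^ M ≠ u ^ M) (r : Fin M) : v ≠ u * q0 M K ^ (2 * (r : ℕ)) := by
  rintro rfl
  exact h (mul_q0_pow_pow hM hK u r)

/-- A weak form of `mulVec_betheVector`, the part of it that survives adding strings. -/
theorem exists_mulVec_betheVector (hz : ∀ i, z i ≠ 0) {γ e : ℂ} {Y : ℂ → Op s}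
    (hY : ExchangeRel e Y (opB s z γ)) {y : ℂ → ℂ}
    (hvac : ∀ v, (Y v).mulVec (vacuum s) = y v • vacuum s) (ht : IsOffdiagonal t) {w : ℂ}
    (hw : ∀ a, w ≠ t a) :
    ∃ φ, (Y w).mulVec (betheVector s z γ t) =
      (y w * ∏ a, wanted e w (t a)) • betheVector s z γ t + (opB s z γ w).mulVec φ := by
  refine ⟨∑ r, (unwanted e w (t r) * (∏ a ∈ Finset.univ.erase r, wanted e (t r) (t a)) * y (t r)) •
    (List.ofFn fun a => if a = r then 1 else opB s z γ (t a)).prod.mulVec (vacuum s), ?_⟩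
  rw [mulVec_betheVector s z t hz hY hvac ht hw, Matrix.mulVec_sum]
  simp only [Matrix.mulVec_smul]

/-- Away from the strings through the `t_a` and the `u_i`, the operators `A(v)` and `D(v)` act on
`|||t; u⟫` by scalars up to the image of `B(v)`. -/
theorem exists_mulVec_extBetheVector (hz : ∀ i, z i ≠ 0) (hM : 1 < M)
    (hK : IsCoprime K (M : ℤ)) (ht : IsOffdiagonal t) {v : ℂ} (hvt : ∀ a, v ≠ t a)
    {m : ℕ} {u : Fin m → ℂ} (hF : ∀ i, funF s z M K t p (u i) ≠ 0) (hvu : ∀ i, v ^ M ≠ u i ^ M) :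
    (∃ φ, (opA s z (rootAngle M K) v).mulVec (extBetheVector s z M K t p u) =
      (q0 M K ^ (m * M) * (vacA s z (rootAngle M K) v * ∏ a, wanted (q0 M K) v (t a))) •
        extBetheVector s z M K t p u + (opB s z (rootAngle M K) v).mulVec φ) ∧
    (∃ φ, (opD s z (rootAngle M K) v).mulVec (extBetheVector s z M K t p u) =
      (q0 M K ^ (m * M) * (vacD s z (rootAngle M K) v * ∏ a, wanted (q0 M K)⁻¹ v (t a))) •
        extBetheVector s z M K t p u + (opB s z (rootAngle M K) v).mulVec φ) := by
  induction m with
  | zero =>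
    rw [extBetheVector_zero, zero_mul, pow_zero, one_mul, one_mul]
    exact ⟨exists_mulVec_betheVector s z t hz (exchangeRel_opA s z hz _)
      (opA_mulVec_vacuum s z _ hz) ht hvt, exists_mulVec_betheVector s z t hz
      (exchangeRel_opD s z hz _) (opD_mulVec_vacuum s z _ hz) ht hvt⟩
  | succ m ih =>
    have hpow : q0 M K ^ ((m + 1) * M) = q0 M K ^ M * q0 M K ^ (m * M) := by
      rw [← pow_add]; ring_nf
    rw [extBetheVector_succ, hpow, mul_assoc, mul_assoc]
    rcases eq_or_ne (u 0) 0 with hu | hu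
    · rw [hu, limB_zero s z hz hM hK]
      simp only [Matrix.zero_mulVec, Matrix.mulVec_zero, smul_zero, zero_add]
      exact ⟨⟨0, by simp⟩, ⟨0, by simp⟩⟩
    · obtain ⟨⟨φ₁, h₁⟩, ⟨φ₂, h₂⟩⟩ := ih (u := fun i => u i.succ) (fun i => hF i.succ)
        fun i => hvu i.succ
      have hA := exchange_opA_limB s z t p hz hM hK hu (hF 0)
        (ne_string_of_pow_ne hM hK (hvu 0))
      have hD := exchange_opD_limB s z t p hz hM hK hu (hF 0)
        (ne_string_of_pow_ne hM hK (hvu 0))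
      rw [sub_eq_add_neg, ← Finset.sum_neg_distrib] at hD
      simp only [← neg_smul] at hD
      exact ⟨mulVec_limB_mulVec s z hz hM hK hA h₁, mulVec_limB_mulVec s z hz hM hK hD h₂⟩

/-- Adding one string at a generic `u`: the two unwanted terms cancel by the choice of `Q`. -/
theorem transferMatrix_mulVec_limB (hz : ∀ i, z i ≠ 0) (hM : 1 < M)
    (hK : IsCoprime K (M : ℤ)) {κ : ℂ} (hκ : κ = q0 M K ^ (2 * p - ∑ i, (s i : ℤ)))
    (ht : IsOffdiagonal t) {m : ℕ} {u : Fin m → ℂ} (hF : ∀ i, funF s z M K t p (u i) ≠ 0)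
    {x : ℂ} (hx : x ≠ 0) (hFx : funF s z M K t p x ≠ 0) (hxt : ∀ a, x ^ M ≠ t a ^ M)
    (hxu : ∀ i, x ^ M ≠ u i ^ M) {w c : ℂ} (hwx : w ^ M ≠ x ^ M)
    (hw : (transferMatrix s z κ (rootAngle M K) w).mulVec (extBetheVector s z M K t p u) =
      c • extBetheVector s z M K t p u) :
    (transferMatrix s z κ (rootAngle M K) w).mulVec
        ((limB s z M K x (xVec s z M K t p x)).mulVec (extBetheVector s z M K t p u)) =
      (q0 M K ^ M * c) • (limB s z M K x (xVec s z M K t p x)).mulVec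
        (extBetheVector s z M K t p u) := by
  have hq := q0_ne_zero (M := M) (K := K)
  have hA := exchange_opA_limB s z t p hz hM hK hx hFx (ne_string_of_pow_ne hM hK hwx)
  have hD := exchange_opD_limB s z t p hz hM hK hx hFx (ne_string_of_pow_ne hM hK hwx)
  set ψ := extBetheVector s z M K t p u with hψ
  set 𝔹 := limB s z M K x (xVec s z M K t p x) with h𝔹
  have hU : ∀ r : Fin M, (x * q0 M K ^ (2 * (r : ℕ))) ^ M = x ^ M := fun r =>
    mul_q0_pow_pow hM hK x r
  have ht1 : ∀ (r : Fin M) a, x * q0 M K ^ (2 * (r : ℕ)) ≠ t a := fun r a h =>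
    hxt a (by rw [← hU r, h])
  have hsq : (q0 M K ^ 2) ^ M = 1 := (isPrimitiveRoot_q0_sq (by omega) hK).pow_eq_one
  have ht2 : ∀ (r : Fin M) a, x * q0 M K ^ (2 * (r : ℕ)) ≠ t a * q0 M K ^ 2 := fun r a h =>
    hxt a (by rw [← hU r, h, mul_pow, hsq, mul_one])
  have ht3 : ∀ (r : Fin M) a, x * q0 M K ^ (2 * (r : ℕ)) * q0 M K ^ 2 ≠ t a := fun r a h =>
    hxt a (by rw [← h, mul_pow, hU, hsq, mul_one])
  have hcancel : ∀ r : Fin M, ∀ C : ℂ,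
      (C * funQ s z M K t p (x * q0 M K ^ (2 * (r : ℕ)))) •
        (opB s z (rootAngle M K) w * (List.ofFn fun a : Fin M =>
          if a = r then 1 else opB s z (rootAngle M K) (x * q0 M K ^ (2 * (a : ℕ)))).prod *
          opA s z (rootAngle M K) (x * q0 M K ^ (2 * (r : ℕ)))).mulVec ψ =
      κ • (C * funQ s z M K t p (x * q0 M K ^ (2 * (r : ℕ)) * q0 M K ^ 2)) •
        (opB s z (rootAngle M K) w * (List.ofFn fun a : Fin M =>
          if a = r then 1 else opB s z (rootAngle M K) (x * q0 M K ^ (2 * (a : ℕ)))).prod *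
          opD s z (rootAngle M K) (x * q0 M K ^ (2 * (r : ℕ)))).mulVec ψ := by
    intro r C
    obtain ⟨⟨φ₁, h₁⟩, ⟨φ₂, h₂⟩⟩ := exists_mulVec_extBetheVector s z t p hz hM hK ht
      (v := x * q0 M K ^ (2 * (r : ℕ))) (ht1 r) hF fun i => by rw [hU]; exact hxu i
    rw [mul_assoc (opB s z _ w), mul_assoc (opB s z _ w), ← Matrix.mulVec_mulVec,
      ← Matrix.mulVec_mulVec _ (opB s z _ w), prod_ite_mul_mulVec s z hz hM hK x r h₁,
      prod_ite_mul_mulVec s z hz hM hK x r h₂, Matrix.mulVec_smul, Matrix.mulVec_smul, smul_smul,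
      smul_smul, smul_smul]
    congr 1
    have h := funQ_mul_vacA s z t p hκ (ht1 r) (ht2 r) (ht3 r)
    linear_combination C * q0 M K ^ (m * M) * h
  have hsum := Finset.sum_congr rfl fun (r : Fin M) (_ : r ∈ Finset.univ) =>
    hcancel r (2 * q0 M K ^ M * (q0 M K)⁻¹ / funF s z M K t p x *
      (x * q0 M K ^ (2 * (r : ℕ)) / (w - x * q0 M K ^ (2 * (r : ℕ)))))
  rw [← Finset.smul_sum] at hsum
  rw [transferMatrix_mulVec] at hw ⊢
  have hw' := congrArg 𝔹.mulVec hw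
  rw [Matrix.mulVec_add, Matrix.mulVec_smul, Matrix.mulVec_smul] at hw'
  rw [Matrix.mulVec_mulVec, Matrix.mulVec_mulVec, hA, hD, Matrix.add_mulVec, Matrix.sub_mulVec,
    Matrix.smul_mulVec, Matrix.smul_mulVec, ← Matrix.mulVec_mulVec, ← Matrix.mulVec_mulVec,
    Matrix.sum_mulVec, Matrix.sum_mulVec]
  simp only [Matrix.smul_mulVec] at hsum ⊢
  rw [hsum]
  linear_combination (norm := module) (q0 M K ^ M) • hw'

/-- `X(u; t)` and `F(u; t)` are continuous in `u` where no denominator vanishes. The assumption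
`x ≠ 0` is needed because the exponent `k - p` may be negative. -/
theorem continuousAt_xVec (hM : 1 < M) (hK : IsCoprime K (M : ℤ)) {x : ℂ} (hx : x ≠ 0)
    (hF : funF s z M K t p x ≠ 0) (hxt : ∀ a, x ^ M ≠ t a ^ M) :
    ContinuousAt (fun x => xVec s z M K t p x) x ∧
      ContinuousAt (fun x => funF s z M K t p x) x := by
  have hsq : (q0 M K ^ 2) ^ M = 1 := (isPrimitiveRoot_q0_sq (by omega) hK).pow_eq_one
  have hQ : ∀ v : ℂ, v ≠ 0 → v ^ M = x ^ M → ContinuousAt (fun v => funQ s z M K t p v) v := by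
    intro v hv hvx
    have hP : Continuous fun v => polyP s z M K v := by
      unfold polyP
      fun_prop
    refine ((continuousAt_id.zpow₀ _ (Or.inl hv)).mul hP.continuousAt).div
      (by fun_prop) (Finset.prod_ne_zero_iff.2 fun a _ => mul_ne_zero ?_ ?_)
    · refine sub_ne_zero.2 fun h => hxt a ?_
      rw [← hvx, h]
    · refine sub_ne_zero.2 fun h => hxt a ?_
      rw [← hvx, h, mul_pow, hsq, mul_one]
  have hQ' : ∀ r r' : ℕ, ContinuousAt
      (fun x => funQ s z M K t p (x * q0 M K ^ (2 * r') * q0 M K ^ (2 * r))) x := by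
    intro r r'
    have hq := q0_ne_zero (M := M) (K := K)
    refine ContinuousAt.comp (f := fun x => x * q0 M K ^ (2 * r') * q0 M K ^ (2 * r))
      (hQ _ ?_ ?_) (by fun_prop)
    · exact mul_ne_zero (mul_ne_zero hx (pow_ne_zero _ hq)) (pow_ne_zero _ hq)
    · rw [mul_q0_pow_pow hM hK, mul_q0_pow_pow hM hK]
  have hFc : ContinuousAt (fun x => funF s z M K t p x) x := by
    unfold funF
    refine continuousAt_const.mul (tendsto_finsetSum _ fun r _ => ?_)
    simpa using (hQ' r 0).tendsto
  refine ⟨continuousAt_pi.2 fun r => ?_, hFc⟩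
  unfold xVec xCoord
  refine continuousAt_const.mul (continuousAt_const.sub (ContinuousAt.div ?_ hFc hF))
  unfold funG
  exact continuousAt_const.mul (tendsto_finsetSum _ fun j _ =>
    (continuousAt_const.mul (hQ' j (r + 1))).tendsto)

theorem eventually_nhdsNE_pow_ne (hM : 1 < M) (x c : ℂ) : ∀ᶠ v in 𝓝[≠] x, v ^ M ≠ c := by
  have hfin : {v : ℂ | v ^ M = c}.Finite := by
    refine ((Polynomial.nthRoots M c).toFinset.finite_toSet).subset fun v hv => ?_
    simpa [Polynomial.mem_nthRoots (show 0 < M by omega)] using hv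
  have h := (hfin.subset (Set.sdiff_subset (t := {x}))).isClosed.isOpen_compl.mem_nhds
    (x := x) (by simp)
  filter_upwards [mem_nhdsWithin_of_mem_nhds h, self_mem_nhdsWithin] with v h1 h2 h3
  exact h1 ⟨h3, h2⟩

/-- The eigenvector equation. The case of strings that coincide with each other, or that pass
through `w`, follows from the generic case by continuity in the base point of the first string. -/
theorem transferMatrix_mulVec_extBetheVector (hz : ∀ i, z i ≠ 0) (hM : 1 < M)
    (hK : IsCoprime K (M : ℤ)) {κ : ℂ} (hκ : κ = q0 M K ^ (2 * p - ∑ i, (s i : ℤ)))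
    (hBethe : IsBetheSolution s z κ (rootAngle M K) t) (ht : IsOffdiagonal t) {m : ℕ}
    {u : Fin m → ℂ} (hF : ∀ i, funF s z M K t p (u i) ≠ 0) (hut : ∀ i a, u i ^ M ≠ t a ^ M)
    {w : ℂ} (hw : ∀ a, w ≠ t a) :
    (transferMatrix s z κ (rootAngle M K) w).mulVec (extBetheVector s z M K t p u) =
      (q0 M K ^ (m * M) * betheEigenvalue s z κ (rootAngle M K) t w) •
        extBetheVector s z M K t p u := by
  induction m with
  | zero =>
    rw [extBetheVector_zero, zero_mul, pow_zero, one_mul]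
    exact transferMatrix_mulVec_betheVector s z t hz hBethe ht hw
  | succ m ih =>
    have hpow : q0 M K ^ ((m + 1) * M) = q0 M K ^ M * q0 M K ^ (m * M) := by
      rw [← pow_add]; ring_nf
    rw [extBetheVector_succ, hpow, mul_assoc]
    rcases eq_or_ne (u 0) 0 with hu | hu
    -- `𝔹(0; X) = 0`, so both sides vanish
    · rw [hu, limB_zero s z hz hM hK]
      simp
    have ih' := ih (u := fun i => u i.succ) (fun i => hF i.succ) fun i => hut i.succ
    set ψ := extBetheVector s z M K t p fun i => u i.succ
    obtain ⟨hXc, hFc⟩ := continuousAt_xVec s z t p hM hK hu (hF 0) (hut 0)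
    have hBc : ContinuousAt (fun x => (limB s z M K x (xVec s z M K t p x)).mulVec ψ) (u 0) := by
      have h1 : ContinuousAt (fun x => limB s z M K x (xVec s z M K t p x)) (u 0) :=
        ContinuousAt.comp (f := fun x => (x, xVec s z M K t p x))
          (continuous_limB s z hz hM hK).continuousAt (continuousAt_id.prodMk hXc)
      exact ContinuousAt.comp (g := fun A : Op s => A.mulVec ψ)
        (continuous_id.matrix_mulVec continuous_const).continuousAt h1
    have hl : Tendsto (fun x => (transferMatrix s z κ (rootAngle M K) w).mulVec
        ((limB s z M K x (xVec s z M K t p x)).mulVec ψ)) (𝓝[≠] (u 0))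
        (𝓝 ((transferMatrix s z κ (rootAngle M K) w).mulVec
          ((limB s z M K (u 0) (xVec s z M K t p (u 0))).mulVec ψ))) :=
      ((continuous_const.matrix_mulVec continuous_id).tendsto _).comp
        (hBc.tendsto.mono_left nhdsWithin_le_nhds)
    refine tendsto_nhds_unique hl (Tendsto.congr' ?_
      ((hBc.tendsto.mono_left nhdsWithin_le_nhds).const_smul _))
    filter_upwards [mem_nhdsWithin_of_mem_nhds (hFc.eventually_ne (hF 0)),
      mem_nhdsWithin_of_mem_nhds (eventually_ne_nhds hu),
      eventually_all.2 fun a => eventually_nhdsNE_pow_ne hM (u 0) (t a ^ M),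
      eventually_all.2 fun i : Fin m => eventually_nhdsNE_pow_ne hM (u 0) (u i.succ ^ M),
      eventually_nhdsNE_pow_ne hM (u 0) (w ^ M)] with x h1 h2 h3 h4 h5
    exact (transferMatrix_mulVec_limB s z t p hz hM hK hκ ht (fun i => hF i.succ) h2 h1 h3 h4
      h5.symm ih').symm

end Induction

end XXZ

theorem proposition3p1 {N : ℕ} (s : Fin N → ℕ) (z : Fin N → ℂ) (hz : ∀ i, z i ≠ 0)
    (M : ℕ) (hM : 1 < M) (K : ℤ) (hK : IsCoprime K (M : ℤ)) :
    -- the limit that defines the operators `𝔹(v; X)` exists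
    (∀ (v : ℂ) (X : Fin M → ℂ),
      Filter.Tendsto (XXZ.regB s z M K v X)
        (nhdsWithin (XXZ.rootAngle M K) {XXZ.rootAngle M K}ᶜ)
        (nhds (XXZ.limB s z M K v X))) ∧
    -- the eigenvector equation
    ∀ (p : ℤ) (κ : ℂ), κ = XXZ.q0 M K ^ (2 * p - ∑ i, (s i : ℤ)) →
      ∀ (k : ℕ) (t : Fin k → ℂ),
        XXZ.IsBetheSolution s z κ (XXZ.rootAngle M K) t → XXZ.IsOffdiagonal t →
        ∀ (m : ℕ) (u : Fin m → ℂ),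
          (∀ i, XXZ.funF s z M K t p (u i) ≠ 0) →
          (∀ i a, u i ^ M ≠ t a ^ M) →
          ∀ w : ℂ, (∀ a, w ≠ t a) →
            (XXZ.transferMatrix s z κ (XXZ.rootAngle M K) w).mulVec
                (XXZ.extBetheVector s z M K t p u) =
              (XXZ.q0 M K ^ (m * M) *
                  XXZ.betheEigenvalue s z κ (XXZ.rootAngle M K) t w) •
                XXZ.extBetheVector s z M K t p u := by
  exact ⟨fun v X => XXZ.tendsto_regB s z hz hM hK v X, fun p κ hκ k t hBethe ht m u hF hut w hw =>
    XXZ.transferMatrix_mulVec_extBetheVector s z t p hz hM hK hκ hBethe ht hF hut hw⟩
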